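/- Let $L^1=L^1([0,2\pi])$ be the space of (a.e. classes of) real Lebesgue integrable functions on $[0,2\pi]$ with $\|f\|_1=\int_0^{2\pi}|f|\,dx$, and for $f\in L^1$ let $S[f]=\frac{a_0}{2}+\sum_{n\ge 1}(a_n\cos nx+b_n\sin nx)$ be its Fourier series, where $a_n=\frac1\pi\int_0^{2\pi}f(t)\cos nt\,dt$ and $b_n=\frac1\pi\int_0^{2\pi}f(t)\sin nt\,dt$. A rational step function is given by finitely many pairs of rationals $(a_1,b_1),\dots,(a_t,b_t)$ with $a_1<\dots<a_t$; it is the function on $[0,2\pi]$ with value $b_i$ on $[a_i,a_{i+1})$ for $1\le i\le t-1$ and value $0$ outside $[a_1,a_t)$. A rational ball is a set $B(\psi,\epsilon)=\{f\in L^1:\|f-\psi\|_1<\epsilon\}$ with $\psi$ a rational step function and $\epsilon>0$ rational; $\mathcal B$ is the set of rational balls. An indexed constructor is a map $\alpha:\mathcal B\times\mathbb N\to\mathcal B$ with $\alpha(B,i)\subseteq B$ for all $B,i$; it is computable if some Turing machine, given any description of $B$ (the endpoints of a step function and a radius) and $i$, outputs a description of $\alpha(B,i)$. A set $X\subseteq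 L^1$ is $L^1_{\mathrm{rec}}$-meager if $X=\bigcup_{i\ge0}X_i$ for some sets $X_i$ for which there is a computable indexed constructor $\alpha$ with $\alpha(B,i)\cap X_i=\emptyset$ for all $B\in\mathcal B$ and $i\in\mathbb N$. An indexed constructor $\beta$ is shrinking if the radius of $\beta(B,i)$ is always less than half the radius of $B$. It wins the Banach–Mazur game against $X$ if, for every indexed constructor $\alpha$ (computable or not) and every $B\in\mathcal B$, the balls $R_0=\beta(\alpha(B,0),0)$, $R_i=\beta(\alpha(R_{i-1},i),i)$ $(i\ge1)$ have exactly one common element $f\in L^1$, and $f\notin X$. **Theorem.** Let $X$ be the set of all $f\in L^1$ for which it is not the case that $S[f]$ diverges at almost every $x\in[0,2\pi]$. Then $X$ is $L^1_{\mathrm{rec}}$-meager, and there is a computable shrinking indexed constructor $\beta$ that wins the Banach–Mazur game against $X$. -/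

import Mathlib

open MeasureTheory Filter Topology

noncomputable section

namespace LOneRec

/-! ## The space `L¹[0,2π]` -/

/-- Lebesgue measure on `[0,2π]`. -/
abbrev mu : Measure ℝ := volume.restrict (Set.Icc 0 (2 * Real.pi))

/-- The Banach space of (a.e. classes of) real Lebesgue integrable functions on `[0,2π]`,
with the metric `d(f,g) = ∫₀^{2π} |f - g|`. -/
abbrev LOne : Type := Lp ℝ 1 mu

/-! ## Rational step functions -/

/-- The step function with endpoints `(a₁,b₁), …, (a_t,b_t)`: it takes the value `b_i` on
`[a_i, a_{i+1})` for `1 ≤ i ≤ t - 1` and the value `0` outside `[a₁, a_t)`. -/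
def stepFun : List (ℚ × ℚ) → ℝ → ℝ
  | [] => fun _ => 0
  | [_] => fun _ => 0
  | p :: q :: l => fun x =>
      (Set.Ico (p.1 : ℝ) (q.1 : ℝ)).indicator (fun _ => (p.2 : ℝ)) x + stepFun (q :: l) x

/-- The endpoints `a₁ < a₂ < … < a_t` are listed in strictly increasing order. -/
def IsEndpointList (l : List (ℚ × ℚ)) : Prop :=
  l.Pairwise (fun p q => p.1 < q.1)

theorem memLp_stepFun : ∀ l : List (ℚ × ℚ), MemLp (stepFun l) 1 mu
  | [] => by
      have h : stepFun [] = fun _ => (0 : ℝ) := rfl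
      rw [h]; exact memLp_const 0
  | [p] => by
      have h : stepFun [p] = fun _ => (0 : ℝ) := rfl
      rw [h]; exact memLp_const 0
  | p :: q :: l =>
      ((memLp_const (p.2 : ℝ)).indicator measurableSet_Ico).add (memLp_stepFun (q :: l))

/-- The class in `L¹[0,2π]` of the rational step function with the given endpoints. -/
def stepClass (l : List (ℚ × ℚ)) : LOne := (memLp_stepFun l).toLp (stepFun l)

/-! ## Rational balls -/

/-- A rational ball: its centre is a rational step function (as an element of `L¹[0,2π]`) and its
radius is a positive rational number. -/
structure RatBall where
  center : LOne
  radius : ℚ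
  radius_pos : 0 < radius
  center_step : ∃ l : List (ℚ × ℚ), IsEndpointList l ∧ center = stepClass l

/-- The open ball `{f | ‖f - ψ‖₁ < ε}`. -/
def RatBall.toSet (B : RatBall) : Set LOne := Metric.ball B.center (B.radius : ℝ)

/-! ## Finite descriptions of rational balls, as input and output of machines -/

/-- A pair `(n, d)` describes the rational number `n / (d + 1)`. -/
def ratVal (q : ℤ × ℕ) : ℚ := (q.1 : ℚ) / ((q.2 : ℚ) + 1)

/-- A finite list of endpoints `(a_i, b_i)` together with a radius. -/
abbrev BallCode : Type := List ((ℤ × ℕ) × (ℤ × ℕ)) × (ℤ × ℕ)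

/-- The list of rational pairs `(a_i, b_i)` in a code. -/
def BallCode.endpoints (c : BallCode) : List (ℚ × ℚ) :=
  c.1.map (fun p => (ratVal p.1, ratVal p.2))

/-- The code `c` describes the rational ball `B`. -/
def Describes (c : BallCode) (B : RatBall) : Prop :=
  IsEndpointList (BallCode.endpoints c) ∧ B.center = stepClass (BallCode.endpoints c) ∧
    B.radius = ratVal c.2

/-! ## Constructors and meager sets -/

/-- An indexed constructor (strategy): a map `α` from (rational ball, index) to rational balls with
`α(B,i) ⊆ B`. -/
structure Constructor where
  move : RatBall → ℕ → RatBall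
  move_subset : ∀ B i, (move B i).toSet ⊆ B.toSet

/-- An indexed constructor is computable if one recursive function (equivalently one Turing
machine) sends every description of every rational ball `B`, and every index `i`, to a description
of `α(B,i)`. -/
def Constructor.IsComputable (α : Constructor) : Prop :=
  ∃ F : BallCode × ℕ → BallCode, Computable F ∧
    ∀ (c : BallCode) (B : RatBall) (i : ℕ), Describes c B → Describes (F (c, i)) (α.move B i)

/-- `X` is `L¹_rec`-meager. -/
def IsRecMeager (X : Set LOne) : Prop :=
  ∃ Y : ℕ → Set LOne, X = ⋃ i, Y i ∧
    ∃ α : Constructor, α.IsComputable ∧ ∀ (B : RatBall) (i : ℕ), (α.move B i).toSet ∩ Y i = ∅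

/-! ## Banach-Mazur games -/

/-- `β` is shrinking: the radius of `β(B,i)` is less than half the radius of `B`. -/
def Constructor.IsShrinking (β : Constructor) : Prop :=
  ∀ (B : RatBall) (i : ℕ), (β.move B i).radius < B.radius / 2

/-- The balls `R₀ = β(α(B,0),0)` and `R_i = β(α(R_{i-1},i),i)` of the game between `α` and `β`
with initial ball `B`. -/
def play (α β : Constructor) (B : RatBall) : ℕ → RatBall
  | 0 => β.move (α.move B 0) 0
  | i + 1 => β.move (α.move (play α β B i) (i + 1)) (i + 1)

/-- `β` wins the Banach-Mazur game against `X`: for every (not necessarily computable) indexed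
constructor `α` and every initial ball, the game has a result, that is, exactly one function lies
in all the balls `R_i`, and this function is not in `X`. -/
def Constructor.Wins (β : Constructor) (X : Set LOne) : Prop :=
  ∀ (α : Constructor) (B : RatBall),
    ∃ f : LOne, ⋂ i, (play α β B i).toSet = {f} ∧ f ∉ X

/-! ## Fourier series -/

/-- `a_n = (1/π) ∫₀^{2π} f(t) cos(nt) dt`. -/
def cosCoeff (f : LOne) (n : ℕ) : ℝ :=
  1 / Real.pi * ∫ t in (0 : ℝ)..(2 * Real.pi), f t * Real.cos (n * t)

/-- `b_n = (1/π) ∫₀^{2π} f(t) sin(nt) dt`. -/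
def sinCoeff (f : LOne) (n : ℕ) : ℝ :=
  1 / Real.pi * ∫ t in (0 : ℝ)..(2 * Real.pi), f t * Real.sin (n * t)

/-- The partial sum `S_l(f,x) = a₀/2 + ∑_{n=1}^l (a_n cos nx + b_n sin nx)`. -/
def fourierPartialSum (f : LOne) (l : ℕ) (x : ℝ) : ℝ :=
  cosCoeff f 0 / 2 +
    ∑ n ∈ Finset.Icc 1 l, (cosCoeff f n * Real.cos (n * x) + sinCoeff f n * Real.sin (n * x))

/-- The Fourier series of `f` diverges at `x`: its partial sums have no (finite) limit. -/
def FourierDivergesAt (f : LOne) (x : ℝ) : Prop :=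
  ¬ ∃ s : ℝ, Tendsto (fun l : ℕ => fourierPartialSum f l x) atTop (𝓝 s)

/-- The Fourier series of `f` diverges at almost every point of `[0,2π]`. -/
def FourierDivergesAE (f : LOne) : Prop :=
  ∀ᵐ x ∂mu, FourierDivergesAt f x

end LOneRec

end

/-! Everything rests on Kolmogorov's lemma in a form that can be found by search. Near any step
function, and for any `M` and `η`, there is a step function on a rational grid for which some
partial sum of bounded order exceeds `M` in modulus outside a set of measure `η` (`kolmogorov`). A
partial sum of fixed order is continuous in the `L¹` norm, so the same holds, with slightly worse
constants, on a whole ball around that function.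

Kolmogorov's lemma: put masses `w` at the points `4πi/(2n+1)`, `1 ≤ i ≤ n`. For orders `k` with
`2k+1` divisible by `2n+1`, the Dirichlet kernels at all masses to the right of `x` carry the same
factor `sin((k+1/2)x)`, so they add up to a harmonic sum (`le_abs_sum_dirichlet`). The masses are
replaced one at a time, from left to right, by bumps supported just to their left (`exists_bump`).
Between two nodes the function built so far still equals the initial one, so by localization
(`tendsto_dirInt`) its high partial sums stay bounded and cannot cancel the harmonic sum
(`ae_exists_lt_abs`). `kolmogorov_stage` is the induction.

Effectivity: all requirements on the new ball are put into a finite certificate whose validity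
`Good` is a primitive recursive relation between rationals: Wallis bounds replace `2π` and Taylor
polynomials replace cosines. A valid certificate does what is wanted (`Good.dist_lt`,
`Good.measure_le`), and one always exists (`exists_good`), so unbounded search finds it. The answer
must depend on the ball and not on its description. Equality of described balls is decidable because
`2π` is irrational, so the search starts from a computable normal form (`exists_normal_form`).

In every ball `β(B,i)` all functions have partial sums bounded by `i` only on a set of measure at
most `1/(i+1)`. A function lying in some `β(B,i)` for each `i` therefore has almost everywhere
unbounded partial sums. The one constructor `β` thus witnesses meagerness and wins the game. -/

noncomputable section

namespace LOneRec

/-! ## Dirichlet kernels and partial sums -/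

/-- The Dirichlet kernel `1/2 + cos y + ⋯ + cos (k y)`. -/
def dirichlet (k : ℕ) (y : ℝ) : ℝ := 1 / 2 + ∑ m ∈ Finset.Icc 1 k, Real.cos (m * y)

theorem two_sin_mul_dirichlet (k : ℕ) (y : ℝ) :
    2 * Real.sin (y / 2) * dirichlet k y = Real.sin ((k + 1 / 2) * y) := by
  induction k with
  | zero => 
    simp only [dirichlet, zero_lt_one, Finset.Icc_eq_empty_of_lt, Finset.sum_empty,
      Nat.cast_zero, zero_add, add_zero]
    rw [show (1 : ℝ) / 2 * y = y / 2 by ring]; ring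
  | succ k ih =>
    have h : dirichlet (k + 1) y = dirichlet k y + Real.cos ((k + 1 : ℕ) * y) := by
      simp only [dirichlet]
      rw [Finset.sum_Icc_succ_top (by omega)]; ring
    rw [h, mul_add, ih]
    have e1 : ((k : ℝ) + 1 / 2) * y = (k + 1 : ℕ) * y - y / 2 := by push_cast; ring
    have e2 : (((k + 1 : ℕ) : ℝ) + 1 / 2) * y = (k + 1 : ℕ) * y + y / 2 := by push_cast; ring
    rw [e1, e2, Real.sin_add, Real.sin_sub]; ring

theorem continuous_dirichlet (k : ℕ) : Continuous (dirichlet k) := by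
  unfold dirichlet; fun_prop

theorem abs_dirichlet_le (k : ℕ) (y : ℝ) : |dirichlet k y| ≤ k + 1 / 2 := by
  unfold dirichlet
  refine (abs_add_le _ _).trans ?_
  have h : |∑ m ∈ Finset.Icc 1 k, Real.cos (m * y)| ≤ k := by
    refine (Finset.abs_sum_le_sum_abs _ _).trans ?_
    calc ∑ m ∈ Finset.Icc 1 k, |Real.cos (m * y)| ≤ ∑ _m ∈ Finset.Icc 1 k, (1 : ℝ) :=
          Finset.sum_le_sum fun m _ => Real.abs_cos_le_one (m * y)
      _ = k := by simp
  rw [abs_of_pos (by norm_num : (0 : ℝ) < 1 / 2)]; linarith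

theorem abs_cos_sub_cos_le (a b : ℝ) : |Real.cos a - Real.cos b| ≤ |a - b| := by
  have h := Real.lipschitzWith_cos.dist_le_mul a b
  simpa [Real.dist_eq] using h

/-- There are `k` cosines, each `k`-Lipschitz. A crude constant is enough, since grids are refined
only after the order has been bounded. -/
theorem abs_dirichlet_sub_le (k : ℕ) (y z : ℝ) :
    |dirichlet k y - dirichlet k z| ≤ (k : ℝ) ^ 2 * |y - z| := by
  have e : dirichlet k y - dirichlet k z
      = ∑ m ∈ Finset.Icc 1 k, (Real.cos (m * y) - Real.cos (m * z)) := by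
    rw [Finset.sum_sub_distrib]; unfold dirichlet; ring
  rw [e]
  refine (Finset.abs_sum_le_sum_abs _ _).trans ?_
  have h : ∀ m ∈ Finset.Icc 1 k, |Real.cos (m * y) - Real.cos (m * z)| ≤ k * |y - z| := by
    intro m hm
    refine (abs_cos_sub_cos_le _ _).trans ?_
    rw [← mul_sub, abs_mul, Nat.abs_cast]
    gcongr
    exact (Finset.mem_Icc.1 hm).2
  refine (Finset.sum_le_sum h).trans ?_
  simp; ring_nf; rfl

/-- `∫₀^{2π} g(t) D_k(x - t) dt`, which is `π` times the `k`-th Fourier partial sum of `g`. -/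
def dirInt (g : ℝ → ℝ) (k : ℕ) (x : ℝ) : ℝ :=
  ∫ t in (0 : ℝ)..(2 * Real.pi), g t * dirichlet k (x - t)

/-- Integrability on `[0,2π]`. -/
abbrev IntOn (g : ℝ → ℝ) : Prop := IntervalIntegrable g volume 0 (2 * Real.pi)

theorem IntOn.mul_cont {g h : ℝ → ℝ} (hg : IntOn g) (hh : Continuous h) :
    IntOn (fun t => g t * h t) := hg.mul_continuousOn hh.continuousOn

theorem IntOn.mul_dirichlet {g : ℝ → ℝ} (hg : IntOn g) (k : ℕ) (x : ℝ) :
    IntOn (fun t => g t * dirichlet k (x - t)) :=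
  hg.mul_cont ((continuous_dirichlet k).comp (by fun_prop))

theorem intOn_coe (f : LOne) : IntOn f := by
  have h : Integrable f mu := L1.integrable_coeFn f
  rw [IntOn, intervalIntegrable_iff_integrableOn_Icc_of_le Real.two_pi_pos.le]
  exact h

theorem pi_mul_fourierPartialSum (f : LOne) (l : ℕ) (x : ℝ) :
    Real.pi * fourierPartialSum f l x = dirInt f l x := by
  have hf := intOn_coe f
  have hc : ∀ n : ℕ, IntOn (fun t => f t * Real.cos (n * t)) :=
    fun n => hf.mul_cont (by fun_prop)
  have hs : ∀ n : ℕ, IntOn (fun t => f t * Real.sin (n * t)) :=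
    fun n => hf.mul_cont (by fun_prop)
  have e : ∀ t, f t * dirichlet l (x - t) = 1 / 2 * f t + ∑ n ∈ Finset.Icc 1 l,
      (Real.cos (n * x) * (f t * Real.cos (n * t)) +
        Real.sin (n * x) * (f t * Real.sin (n * t))) := by
    intro t
    unfold dirichlet
    rw [mul_add, Finset.mul_sum]
    congr 1
    · ring
    · refine Finset.sum_congr rfl fun n _ => ?_
      rw [mul_sub, Real.cos_sub]; ring
  unfold dirInt
  simp_rw [e]
  rw [intervalIntegral.integral_add (hf.const_mul _), intervalIntegral.integral_finsetSum]
  · unfold fourierPartialSum cosCoeff sinCoeff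
    rw [mul_add, Finset.mul_sum]
    congr 1
    · simp only [intervalIntegral.integral_const_mul]
      have := Real.pi_ne_zero
      field_simp
      simp
    · refine Finset.sum_congr rfl fun n _ => ?_
      rw [intervalIntegral.integral_add ((hc n).const_mul _) ((hs n).const_mul _),
        intervalIntegral.integral_const_mul, intervalIntegral.integral_const_mul]
      have := Real.pi_ne_zero
      field_simp
  · intro n _
    exact ((hc n).const_mul _).add ((hs n).const_mul _)
  · have h := IntervalIntegrable.sum (Finset.Icc 1 l) (μ := volume) (a := 0) (b := 2 * Real.pi)
      (f := fun n t => Real.cos (n * x) * (f t * Real.cos (n * t)) +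
        Real.sin (n * x) * (f t * Real.sin (n * t)))
      fun n _ => ((hc n).const_mul _).add ((hs n).const_mul _)
    refine h.congr fun t _ => ?_
    simp only [Finset.sum_apply]

theorem dirInt_sub {f g : ℝ → ℝ} (hf : IntOn f) (hg : IntOn g) (k : ℕ) (x : ℝ) :
    dirInt (fun t => f t - g t) k x = dirInt f k x - dirInt g k x := by
  unfold dirInt
  rw [← intervalIntegral.integral_sub (hf.mul_dirichlet k x) (hg.mul_dirichlet k x)]
  simp_rw [sub_mul]

theorem dirInt_add {f g : ℝ → ℝ} (hf : IntOn f) (hg : IntOn g) (k : ℕ) (x : ℝ) :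
    dirInt (fun t => f t + g t) k x = dirInt f k x + dirInt g k x := by
  unfold dirInt
  rw [← intervalIntegral.integral_add (hf.mul_dirichlet k x) (hg.mul_dirichlet k x)]
  simp_rw [add_mul]

/-- The `L¹` norm on `[0,2π]`. -/
def nrm (g : ℝ → ℝ) : ℝ := ∫ t in (0 : ℝ)..(2 * Real.pi), |g t|

theorem nrm_nonneg (g : ℝ → ℝ) : 0 ≤ nrm g :=
  intervalIntegral.integral_nonneg Real.two_pi_pos.le fun _ _ => abs_nonneg _

theorem abs_integral_mul_le {g h : ℝ → ℝ} (hg : IntOn g) {C : ℝ} (hC : ∀ t, |h t| ≤ C) :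
    |∫ t in (0 : ℝ)..(2 * Real.pi), g t * h t| ≤ C * nrm g := by
  have h1 := intervalIntegral.norm_integral_le_of_norm_le (μ := volume) (a := 0)
    (b := 2 * Real.pi) (f := fun t => g t * h t) (g := fun t => C * |g t|) Real.two_pi_pos.le
    (Eventually.of_forall fun t _ => by
      rw [Real.norm_eq_abs, abs_mul, mul_comm]
      exact mul_le_mul_of_nonneg_right (hC t) (abs_nonneg _)) (hg.abs.const_mul C)
  rw [intervalIntegral.integral_const_mul] at h1
  exact h1

theorem abs_dirInt_le {g : ℝ → ℝ} (hg : IntOn g) (k : ℕ) (x : ℝ) :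
    |dirInt g k x| ≤ (k + 1 / 2) * nrm g :=
  abs_integral_mul_le hg fun t => abs_dirichlet_le k (x - t)

theorem abs_dirInt_sub_le {g : ℝ → ℝ} (hg : IntOn g) (k : ℕ) (x y : ℝ) :
    |dirInt g k x - dirInt g k y| ≤ (k : ℝ) ^ 2 * |x - y| * nrm g := by
  have e : dirInt g k x - dirInt g k y = ∫ t in (0 : ℝ)..(2 * Real.pi),
      g t * (dirichlet k (x - t) - dirichlet k (y - t)) := by
    unfold dirInt
    rw [← intervalIntegral.integral_sub (hg.mul_dirichlet k x) (hg.mul_dirichlet k y)]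
    simp_rw [mul_sub]
  rw [e]
  refine abs_integral_mul_le hg fun t => ?_
  have := abs_dirichlet_sub_le k (x - t) (y - t)
  rwa [sub_sub_sub_cancel_right] at this

theorem continuous_dirInt {g : ℝ → ℝ} (hg : IntOn g) (k : ℕ) : Continuous (dirInt g k) := by
  refine continuous_iff_continuousAt.2 fun x => tendsto_iff_dist_tendsto_zero.2 ?_
  have h : Tendsto (fun y => (k : ℝ) ^ 2 * |y - x| * nrm g) (𝓝 x) (𝓝 0) := by
    have : ContinuousAt (fun y : ℝ => (k : ℝ) ^ 2 * |y - x| * nrm g) x := by fun_prop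
    simpa using this.tendsto
  exact squeeze_zero (fun _ => dist_nonneg)
    (fun y => by rw [Real.dist_eq]; exact abs_dirInt_sub_le hg k y x) h

theorem dirInt_one (k : ℕ) (x : ℝ) : dirInt (fun _ => 1) k x = Real.pi := by
  unfold dirInt dirichlet
  simp only [one_mul]
  rw [intervalIntegral.integral_add (by simp)
    (Continuous.intervalIntegrable (by fun_prop) _ _), intervalIntegral.integral_finsetSum
    (fun m _ => Continuous.intervalIntegrable (by fun_prop) _ _)]
  have h : ∀ m ∈ Finset.Icc 1 k,
      ∫ t in (0 : ℝ)..(2 * Real.pi), Real.cos (m * (x - t)) = 0 := by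
    intro m hm
    have hm0 : (m : ℝ) ≠ 0 := by
      have := (Finset.mem_Icc.1 hm).1
      positivity
    have e : ∀ t : ℝ, (m : ℝ) * (x - t) = m * x - m * t := fun t => by ring
    simp_rw [e]
    rw [intervalIntegral.integral_comp_sub_mul _ hm0, integral_cos]
    have e2 : (m : ℝ) * x - m * (2 * Real.pi) = m * x - m * (2 * Real.pi) := rfl
    rw [Real.sin_sub_nat_mul_two_pi]
    simp
  rw [Finset.sum_eq_zero h]
  simp only [intervalIntegral.integral_const, smul_eq_mul]
  ring

/-- This is the Riemann–Lebesgue lemma: the integral is the imaginary part of the Fourier transform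
of `F` at `(k+1/2)/(2π)`, multiplied by a factor of modulus one. -/
theorem tendsto_integral_mul_sin {F : ℝ → ℝ} (hF : Integrable F) (x : ℝ) :
    Tendsto (fun k : ℕ => ∫ t, F t * Real.sin ((k + 1 / 2) * (x - t))) atTop (𝓝 0) := by
  have h := Real.tendsto_integral_exp_smul_cocompact (fun t => (F t : ℂ))
  have hw : Tendsto (fun k : ℕ => ((k : ℝ) + 1 / 2) / (2 * Real.pi)) atTop (cocompact ℝ) := by
    refine Tendsto.mono_right ?_ atTop_le_cocompact
    exact (tendsto_atTop_add_const_right _ _ tendsto_natCast_atTop_atTop).atTop_div_const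
      Real.two_pi_pos
  have h2 := (h.comp hw).norm
  rw [norm_zero] at h2
  refine squeeze_zero_norm (fun k => ?_) h2
  set w : ℝ := ((k : ℝ) + 1 / 2) / (2 * Real.pi) with hwdef
  have hw2 : (2 * Real.pi) * w = k + 1 / 2 := by
    rw [hwdef]; field_simp
  have hint : Integrable (fun t => Real.fourierChar (-(t * w)) • (F t : ℂ)) := by
    refine (Integrable.mono (g := F) hF ?_ ?_)
    · simp_rw [Circle.smul_def, smul_eq_mul]
      refine AEStronglyMeasurable.mul ?_ (Complex.continuous_ofReal.comp_aestronglyMeasurable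
        hF.aestronglyMeasurable)
      have hc : Continuous fun t : ℝ => -(t * w) := by fun_prop
      exact (continuous_subtype_val.comp
        (Real.continuous_fourierChar.comp hc)).aestronglyMeasurable
    · exact Eventually.of_forall fun t => by rw [Circle.norm_smul, Complex.norm_real]
  have e : (∫ t, F t * Real.sin ((k + 1 / 2) * (x - t))) =
      (Complex.exp (((k + 1 / 2) * x : ℝ) * Complex.I) *
        ∫ t, Real.fourierChar (-(t * w)) • (F t : ℂ)).im := by
    rw [← integral_const_mul]
    have := (Complex.imCLM.integral_comp_comm (hint.const_mul
      (Complex.exp (((k + 1 / 2) * x : ℝ) * Complex.I))))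
    simp only [Complex.imCLM_apply] at this
    rw [← this]
    congr 1
    ext t
    rw [Circle.smul_def, Real.fourierChar_apply, smul_eq_mul, ← mul_assoc, ← Complex.exp_add,
      Complex.im_mul_ofReal, mul_comm, ← Complex.exp_ofReal_mul_I_im]
    congr 3
    rw [← hw2]; push_cast; ring
  rw [e, Function.comp_apply]
  refine (Complex.abs_im_le_norm _).trans ?_
  rw [norm_mul, Complex.norm_exp_ofReal_mul_I, one_mul]

/-- Localization: at a point of local constancy the partial sums converge to the value. -/
theorem tendsto_dirInt {g : ℝ → ℝ} (hg : IntOn g) {x : ℝ} (hx0 : 0 < x) (hx1 : x < 2 * Real.pi)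
    (hloc : ∀ᶠ t in 𝓝 x, g t = g x) :
    Tendsto (fun k => dirInt g k x) atTop (𝓝 (Real.pi * g x)) := by
  obtain ⟨δ, hδ, hball⟩ := Metric.eventually_nhds_iff.1 hloc
  set S : Set ℝ := Set.Icc 0 (2 * Real.pi) ∩ {t | δ ≤ |t - x|} with hS
  have hSc : IsCompact S := by
    refine isCompact_Icc.inter_right (isClosed_le continuous_const (by fun_prop))
  have hpos : ∀ t ∈ S, 0 < |2 * Real.sin ((x - t) / 2)| := by
    rintro t ⟨⟨h0, h1⟩, h2⟩
    have h2' : δ ≤ |t - x| := h2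
    refine abs_pos.2 (mul_ne_zero two_ne_zero fun h => ?_)
    have hne : (x - t) / 2 ≠ 0 := by
      intro h3
      have : t - x = 0 := by linarith
      rw [this, abs_zero] at h2'
      linarith
    exact hne ((Real.sin_eq_zero_iff_of_lt_of_lt (by linarith) (by linarith)).1 h)
  obtain ⟨c, hc, hcS⟩ : ∃ c > 0, ∀ t ∈ S, c ≤ |2 * Real.sin ((x - t) / 2)| := by
    rcases S.eq_empty_or_nonempty with h | h
    · exact ⟨1, one_pos, by simp [h]⟩
    · obtain ⟨t, ht, hmin⟩ := hSc.exists_isMinOn h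
        (f := fun t => |2 * Real.sin ((x - t) / 2)|) (by fun_prop)
      exact ⟨_, hpos t ht, fun s hs => hmin hs⟩
  -- The singular factor of the Dirichlet kernel, cut off near `x`. The cut is harmless because `g t
  -- - g x` vanishes there, and on the compact set `S` the sine is bounded away from zero.
  set φ : ℝ → ℝ := S.indicator fun t => (2 * Real.sin ((x - t) / 2))⁻¹ with hφ
  have hφm : Measurable φ := by
    refine Measurable.indicator ?_ hSc.measurableSet
    exact Measurable.inv (by fun_prop)
  have hφb : ∀ t, |φ t| ≤ c⁻¹ := by
    intro t
    by_cases ht : t ∈ S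
    · rw [hφ, Set.indicator_of_mem ht, abs_inv]
      exact inv_anti₀ hc (hcS t ht)
    · rw [hφ, Set.indicator_of_notMem ht, abs_zero]; positivity
  set F : ℝ → ℝ := (Set.Ioc 0 (2 * Real.pi)).indicator fun t => φ t * (g t - g x) with hF
  have hFi : Integrable F := by
    rw [hF, integrable_indicator_iff measurableSet_Ioc]
    have h1 : IntegrableOn (fun t => g t - g x) (Set.Ioc 0 (2 * Real.pi)) := by
      rw [← intervalIntegrable_iff_integrableOn_Ioc_of_le Real.two_pi_pos.le]
      exact hg.sub (by simp)
    exact h1.bdd_mul (c := c⁻¹) hφm.aestronglyMeasurable (Eventually.of_forall hφb)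
  have key := tendsto_integral_mul_sin hFi x
  have e : ∀ k : ℕ, dirInt g k x = Real.pi * g x +
      ∫ t, F t * Real.sin ((k + 1 / 2) * (x - t)) := by
    intro k
    have h1 : dirInt (fun t => g t - g x) k x = dirInt g k x - Real.pi * g x := by
      rw [dirInt_sub hg (by simp)]
      congr 1
      have : dirInt (fun _ => g x) k x = g x * dirInt (fun _ => 1) k x := by
        unfold dirInt
        rw [← intervalIntegral.integral_const_mul]
        simp
      rw [this, dirInt_one, mul_comm]
    have h2 : dirInt (fun t => g t - g x) k x =
        ∫ t, F t * Real.sin ((k + 1 / 2) * (x - t)) := by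
      unfold dirInt
      rw [intervalIntegral.integral_of_le Real.two_pi_pos.le, ← integral_indicator measurableSet_Ioc]
      congr 1
      ext t
      by_cases ht : t ∈ Set.Ioc 0 (2 * Real.pi)
      · rw [hF, Set.indicator_of_mem ht, Set.indicator_of_mem ht]
        by_cases hd : δ ≤ |t - x|
        · have htS : t ∈ S := ⟨⟨ht.1.le, ht.2⟩, hd⟩
          rw [hφ, Set.indicator_of_mem htS, ← two_sin_mul_dirichlet]
          have := abs_pos.1 (hpos t htS)
          generalize 2 * Real.sin ((x - t) / 2) = s at this
          simp only []
          field_simp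
        · have : g t = g x := hball (by rw [Real.dist_eq]; exact not_le.1 hd)
          simp only [this, sub_self, zero_mul, mul_zero]
      · rw [hF, Set.indicator_of_notMem ht, Set.indicator_of_notMem ht, zero_mul]
    rw [← h2, h1]; ring
  simp_rw [e]
  simpa using key.const_add (Real.pi * g x)

/-! ## Grid functions -/

/-- The function with value `u j` on `[j/N, (j+1)/N)`. -/
def gridFun (N : ℕ) (u : ℕ → ℚ) (t : ℝ) : ℝ := u ⌊t * N⌋₊

theorem gridFun_refine (N k : ℕ) (hk : 0 < k) (u : ℕ → ℚ) :
    gridFun N u = gridFun (N * k) (fun j => u (j / k)) := by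
  ext t
  have hk' : (k : ℝ) ≠ 0 := by positivity
  simp only [gridFun]
  rw [← Nat.floor_div_natCast]
  congr 3
  push_cast
  field_simp

theorem measurable_gridFun (N : ℕ) (u : ℕ → ℚ) : Measurable (gridFun N u) := by
  unfold gridFun
  exact (measurable_of_countable fun j : ℕ => (u j : ℝ)).comp
    (Nat.measurable_floor.comp (measurable_id.mul_const _))

theorem gridFun_of_mem {N : ℕ} (hN : 0 < N) (u : ℕ → ℚ) {j : ℕ} {t : ℝ}
    (h0 : (j : ℝ) / N ≤ t) (h1 : t < (j + 1 : ℝ) / N) : gridFun N u t = u j := by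
  have hN' : (0 : ℝ) < N := by positivity
  rw [div_le_iff₀ hN'] at h0
  rw [lt_div_iff₀ hN'] at h1
  unfold gridFun
  rw [(Nat.floor_eq_iff (by positivity |> fun h : (0 : ℝ) ≤ j => h.trans h0)).2 ⟨h0, h1⟩]

theorem exists_bound_gridFun (N : ℕ) (u : ℕ → ℚ) (b : ℝ) :
    ∃ C : ℝ, 0 ≤ C ∧ ∀ t ≤ b, |gridFun N u t| ≤ C := by
  refine ⟨∑ j ∈ Finset.range (⌊b * N⌋₊ + 1), |(u j : ℝ)|,
    Finset.sum_nonneg fun _ _ => abs_nonneg _, fun t ht => ?_⟩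
  unfold gridFun
  refine Finset.single_le_sum (f := fun j => |(u j : ℝ)|) (fun _ _ => abs_nonneg _) ?_
  rw [Finset.mem_range, Nat.lt_succ_iff]
  exact Nat.floor_le_floor (by gcongr)

theorem intervalIntegrable_gridFun (N : ℕ) (u : ℕ → ℚ) (a b : ℝ) :
    IntervalIntegrable (gridFun N u) volume a b := by
  obtain ⟨C, -, hC⟩ := exists_bound_gridFun N u (max a b)
  refine (intervalIntegrable_const (c := C)).mono_fun
    (measurable_gridFun N u).aestronglyMeasurable ?_
  refine (ae_restrict_iff' measurableSet_uIoc).2 (Eventually.of_forall fun t ht => ?_)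
  simp only [Real.norm_eq_abs]
  exact (hC t ht.2).trans (le_abs_self C)

theorem integral_gridFun_mul {N : ℕ} (hN : 0 < N) (u : ℕ → ℚ) {h : ℝ → ℝ} (hh : Continuous h)
    (J : ℕ) : ∫ t in (0 : ℝ)..(J / N), gridFun N u t * h t =
      ∑ j ∈ Finset.range J, (u j : ℝ) * ∫ t in ((j : ℝ) / N)..((j + 1 : ℝ) / N), h t := by
  have hN' : (0 : ℝ) < N := by positivity
  have h1 := intervalIntegral.sum_integral_adjacent_intervals (μ := volume)
    (f := fun t => gridFun N u t * h t) (a := fun j : ℕ => (j : ℝ) / N) (n := J)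
    (fun j _ => (intervalIntegrable_gridFun N u _ _).mul_continuousOn hh.continuousOn)
  simp only [Nat.cast_zero, zero_div] at h1
  rw [← h1]
  refine Finset.sum_congr rfl fun j _ => ?_
  have hle : (j : ℝ) / N ≤ (j + 1 : ℝ) / N := by gcongr; linarith
  rw [← intervalIntegral.integral_const_mul, Nat.cast_succ]
  rw [intervalIntegral.integral_of_le hle, intervalIntegral.integral_of_le hle,
    integral_Ioc_eq_integral_Ioo, integral_Ioc_eq_integral_Ioo]
  refine setIntegral_congr_fun measurableSet_Ioo fun t ht => ?_
  simp only [gridFun_of_mem hN u ht.1.le ht.2]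

/-- This is why grid functions are required to vanish before `2π`: the integral up to the irrational
endpoint becomes a sum over complete cells. -/
theorem integral_gridFun_mul_of_le {N : ℕ} (hN : 0 < N) {u : ℕ → ℚ} {h : ℝ → ℝ}
    (hh : Continuous h) {J : ℕ} (hu : ∀ j, J ≤ j → u j = 0) {b : ℝ} (hb : (J : ℝ) / N ≤ b) :
    ∫ t in (0 : ℝ)..b, gridFun N u t * h t =
      ∑ j ∈ Finset.range J, (u j : ℝ) * ∫ t in ((j : ℝ) / N)..((j + 1 : ℝ) / N), h t := by
  have hN' : (0 : ℝ) < N := by positivity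
  have hii : ∀ c d, IntervalIntegrable (fun t => gridFun N u t * h t) volume c d := fun c d =>
    (intervalIntegrable_gridFun N u _ _).mul_continuousOn hh.continuousOn
  rw [← intervalIntegral.integral_add_adjacent_intervals (hii 0 (J / N)) (hii (J / N) b),
    integral_gridFun_mul hN u hh, intervalIntegral.integral_zero_ae, add_zero]
  refine Eventually.of_forall fun t ht => ?_
  rw [Set.uIoc_of_le hb] at ht
  have : gridFun N u t = 0 := by
    unfold gridFun
    rw [hu _ (Nat.le_floor ((div_le_iff₀ hN').1 ht.1.le)), Rat.cast_zero]
  rw [this, zero_mul]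

theorem abs_gridFun (N : ℕ) (u : ℕ → ℚ) (t : ℝ) :
    |gridFun N u t| = gridFun N (fun j => |u j|) t := by
  simp [gridFun]

theorem integral_abs_gridFun {N : ℕ} (hN : 0 < N) (u : ℕ → ℚ) (J : ℕ) :
    ∫ t in (0 : ℝ)..(J / N), |gridFun N u t| = (1 / N : ℝ) * ∑ j ∈ Finset.range J, |(u j : ℝ)| := by
  have h := integral_gridFun_mul hN (fun j => |u j|) (h := fun _ => 1) continuous_const J
  simp_rw [abs_gridFun]
  simp only [mul_one] at h
  rw [h, Finset.mul_sum]
  refine Finset.sum_congr rfl fun j _ => ?_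
  simp
  ring

theorem gridFun_eventually_eq {N : ℕ} (u : ℕ → ℚ) {x : ℝ} (hx0 : 0 < x)
    (hx : ∀ j : ℕ, x * N ≠ j) : ∀ᶠ t in 𝓝 x, gridFun N u t = gridFun N u x := by
  have h0 : (⌊x * N⌋₊ : ℝ) < x * N :=
    lt_of_le_of_ne (Nat.floor_le (by positivity)) (hx _).symm
  have h1 := Nat.lt_floor_add_one (x * N)
  have hc : Tendsto (fun t : ℝ => t * N) (𝓝 x) (𝓝 (x * N)) :=
    (continuous_id.mul continuous_const).tendsto x
  filter_upwards [hc.eventually (lt_mem_nhds h0), hc.eventually (gt_mem_nhds h1)] with t ht0 ht1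
  unfold gridFun
  rw [(Nat.floor_eq_iff ((Nat.cast_nonneg _).trans ht0.le)).2 ⟨ht0.le, ht1⟩]

/-- Grid functions that vanish to the right of some point below `2π`. -/
def IsGrid (f : ℝ → ℝ) : Prop :=
  ∃ N : ℕ, 0 < N ∧ ∃ (u : ℕ → ℚ) (m : ℕ), (m : ℝ) / N < 2 * Real.pi ∧ (∀ j, m ≤ j → u j = 0) ∧
    f = gridFun N u

theorem IsGrid.intOn {f : ℝ → ℝ} (hf : IsGrid f) : IntOn f := by
  obtain ⟨N, -, u, m, -, -, rfl⟩ := hf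
  exact intervalIntegrable_gridFun N u _ _

theorem IsGrid.refine {f : ℝ → ℝ} (hf : IsGrid f) : ∃ N : ℕ, 0 < N ∧ ∀ k : ℕ, 0 < k →
    ∃ (u : ℕ → ℚ) (m : ℕ), (m : ℝ) / (N * k : ℕ) < 2 * Real.pi ∧ (∀ j, m ≤ j → u j = 0) ∧
    f = gridFun (N * k) u := by
  obtain ⟨N, hN, u, m, hm, hu, rfl⟩ := hf
  refine ⟨N, hN, fun k hk => ⟨fun j => u (j / k), m * k, ?_, fun j hj => hu _ ?_,
    gridFun_refine N k hk u⟩⟩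
  · have : (k : ℝ) ≠ 0 := by positivity
    push_cast
    rwa [mul_div_mul_right _ _ this]
  · exact (Nat.le_div_iff_mul_le hk).2 hj

theorem IsGrid.add {f g : ℝ → ℝ} (hf : IsGrid f) (hg : IsGrid g) :
    IsGrid (fun t => f t + g t) := by
  obtain ⟨N, hN, hf⟩ := hf.refine
  obtain ⟨N', hN', hg⟩ := hg.refine
  obtain ⟨u, m, hm, hu, rfl⟩ := hf N' hN'
  obtain ⟨u', m', hm', hu', rfl⟩ := hg N hN
  rw [mul_comm N' N] at *
  refine ⟨N * N', by positivity, fun j => u j + u' j, max m m', ?_, fun j hj => ?_, ?_⟩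
  · rcases max_choice m m' with h | h <;> rw [h] <;> assumption
  · simp only [hu j ((le_max_left _ _).trans hj), hu' j ((le_max_right _ _).trans hj), add_zero]
  · ext t; simp [gridFun]

theorem IsGrid.ae_eventually_eq {f : ℝ → ℝ} (hf : IsGrid f) :
    ∀ᵐ x : ℝ, 0 < x → ∀ᶠ t in 𝓝 x, f t = f x := by
  obtain ⟨N, hN, u, m, -, -, rfl⟩ := hf
  have h : ∀ᵐ x : ℝ, x ∉ Set.range (fun j : ℕ => (j : ℝ) / N) :=
    (Set.countable_range _).ae_notMem volume
  filter_upwards [h] with x hx hx0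
  refine gridFun_eventually_eq u hx0 fun j hj => hx ⟨j, ?_⟩
  have : (N : ℝ) ≠ 0 := by positivity
  simp only [← hj]; field_simp

theorem IsGrid.exists_bound {f : ℝ → ℝ} (hf : IsGrid f) :
    ∃ C : ℝ, 0 ≤ C ∧ ∀ t ≤ 2 * Real.pi, |f t| ≤ C := by
  obtain ⟨N, hN, u, m, -, -, rfl⟩ := hf
  exact exists_bound_gridFun N u _

/-! ## Approximating point masses -/

/-- Just to the left of `y` there are grid functions which act on Dirichlet kernels of bounded
order almost like a point mass `w` at `y`. -/
theorem exists_bump {y : ℝ} (hy0 : 0 < y) (hy1 : y < 2 * Real.pi) {w : ℚ} (hw : 0 < w) (K : ℕ)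
    {ε : ℝ} (hε : 0 < ε) : ∃ b : ℝ → ℝ, IsGrid b ∧ (∀ t, y ≤ t → b t = 0) ∧ nrm b = w ∧
      ∀ k ≤ K, ∀ x, |dirInt b k x - w * dirichlet k (x - y)| ≤ ε := by
  have hw' : (0 : ℝ) < w := by exact_mod_cast hw
  -- The first summand makes room for a full cell to the left of `y`; the second pushes the
  -- Lipschitz error of the kernels below `ε`.
  obtain ⟨N, hN1⟩ := exists_nat_gt (1 / y + 2 * w * K ^ 2 / ε)
  have hNpos : (0 : ℝ) < N := lt_of_le_of_lt (by positivity) hN1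
  have hN0 : 0 < N := by exact_mod_cast hNpos
  have hNy : 1 ≤ y * N := by
    have : 1 / y ≤ N := le_trans (le_add_of_nonneg_right (by positivity)) hN1.le
    rw [div_le_iff₀ hy0] at this; linarith
  have hNK : w * (K ^ 2 * (2 / N)) ≤ ε := by
    have h1 : 2 * w * K ^ 2 / ε ≤ N := le_trans (le_add_of_nonneg_left (by positivity)) hN1.le
    rw [div_le_iff₀ hε] at h1
    have h2 : w * (K ^ 2 * (2 / N)) = 2 * w * K ^ 2 / (N : ℝ) := by ring
    rw [h2, div_le_iff₀ hNpos]; linarith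
  -- Cell `a` is the last one that ends at or before `y`, so all of it lies within `2/N` of `y`. The
  -- value `w * N` on it gives total mass `w`.
  obtain ⟨a, ha⟩ : ∃ a, ⌊y * N⌋₊ = a + 1 :=
    ⟨_, (Nat.succ_pred_eq_of_pos (Nat.floor_pos.2 hNy)).symm⟩
  obtain ⟨ha0, ha1⟩ := (Nat.floor_eq_iff (by positivity)).1 ha
  push_cast at ha0 ha1
  have hay : (a + 1 : ℝ) / N ≤ y := (div_le_iff₀ hNpos).2 ha0
  have hya : y < (a + 2 : ℝ) / N := (lt_div_iff₀ hNpos).2 (by linarith)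
  set u : ℕ → ℚ := fun j => if j = a then w * N else 0 with hu
  have hu0 : ∀ j, a + 1 ≤ j → u j = 0 := fun j hj => if_neg (by omega)
  have hgrid0 : ∀ t, (a + 1 : ℝ) / N ≤ t → gridFun N u t = 0 := by
    intro t ht
    unfold gridFun
    rw [hu0, Rat.cast_zero]
    refine Nat.le_floor ?_
    push_cast
    exact (div_le_iff₀ hNpos).1 ht
  have hint : ∀ h : ℝ → ℝ, Continuous h → ∫ t in (0 : ℝ)..(2 * Real.pi), gridFun N u t * h t =
      w * N * ∫ t in ((a : ℝ) / N)..((a + 1 : ℝ) / N), h t := by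
    intro h hh
    rw [integral_gridFun_mul_of_le hN0 hh hu0 (by push_cast; linarith), Finset.sum_eq_single a]
    · simp [hu]
    · intro j _ hj
      simp [hu, hj]
    · intro h; simp at h
  have hlen : (a + 1 : ℝ) / N - a / N = 1 / N := by ring
  refine ⟨gridFun N u, ⟨N, hN0, u, a + 1, by push_cast; linarith, hu0, rfl⟩,
    fun t ht => hgrid0 t (hay.trans ht), ?_, fun k hk x => ?_⟩
  · have : nrm (gridFun N u) = ∫ t in (0 : ℝ)..(2 * Real.pi), gridFun N u t * 1 := by
      unfold nrm
      congr 1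
      ext t
      rw [mul_one, abs_of_nonneg]
      simp only [gridFun, hu]
      split_ifs <;> positivity
    rw [this, hint _ continuous_const]
    simp only [intervalIntegral.integral_const, hlen, smul_eq_mul]
    field_simp
  · have hcont : Continuous fun t => dirichlet k (x - t) :=
      (continuous_dirichlet k).comp (by fun_prop)
    unfold dirInt
    rw [hint _ hcont]
    have e : (w : ℝ) * N * (∫ t in ((a : ℝ) / N)..((a + 1 : ℝ) / N), dirichlet k (x - t)) -
        w * dirichlet k (x - y) = w * N * ∫ t in ((a : ℝ) / N)..((a + 1 : ℝ) / N),
          (dirichlet k (x - t) - dirichlet k (x - y)) := by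
      rw [intervalIntegral.integral_sub (hcont.intervalIntegrable _ _) (by simp)]
      simp only [intervalIntegral.integral_const, hlen, smul_eq_mul]
      field_simp
    rw [e, abs_mul, abs_of_pos (by positivity : (0 : ℝ) < w * N)]
    have hle : (a : ℝ) / N ≤ (a + 1 : ℝ) / N := by gcongr; linarith
    have hb : ‖∫ t in ((a : ℝ) / N)..((a + 1 : ℝ) / N),
        (dirichlet k (x - t) - dirichlet k (x - y))‖ ≤ (K ^ 2 * (2 / N)) * |(a + 1 : ℝ) / N - a / N| := by
      refine intervalIntegral.norm_integral_le_of_norm_le_const fun t ht => ?_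
      rw [Set.uIoc_of_le hle] at ht
      refine (abs_dirichlet_sub_le k _ _).trans ?_
      have hkK : (k : ℝ) ≤ K := by exact_mod_cast hk
      have : |x - t - (x - y)| ≤ 2 / N := by
        rw [show x - t - (x - y) = y - t by ring, abs_of_nonneg (by linarith [ht.2])]
        have : (a + 2 : ℝ) / N = a / N + 2 / N := by ring
        linarith [ht.1]
      gcongr
    rw [hlen, abs_of_pos (by positivity : (0 : ℝ) < 1 / N), Real.norm_eq_abs] at hb
    calc _ ≤ (w : ℝ) * N * (K ^ 2 * (2 / N) * (1 / N)) := by gcongr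
      _ = w * (K ^ 2 * (2 / N)) := by field_simp
      _ ≤ ε := hNK

/-! ## Kolmogorov's construction -/

/-- Since `sin 3θ = sin θ (3 - 4 sin² θ)`, tripling the angle at least doubles the modulus of the
sine as long as it is below `1/2`. Tripling is used because it keeps odd multiples odd. -/
theorem exists_pow_three_half_le_abs_sin {θ : ℝ} (h : Real.sin θ ≠ 0) :
    ∃ m : ℕ, 1 / 2 ≤ |Real.sin (3 ^ m * θ)| := by
  by_contra! hcon
  have hgrow : ∀ m : ℕ, 2 ^ m * |Real.sin θ| ≤ |Real.sin (3 ^ m * θ)| := by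
    intro m
    induction m with
    | zero => simp
    | succ m ih =>
      have e : (3 : ℝ) ^ (m + 1) * θ = 3 * (3 ^ m * θ) := by ring
      rw [e, Real.sin_three_mul]
      set s := Real.sin (3 ^ m * θ) with hs
      have h1 : |s| < 1 / 2 := hcon m
      have h2 : 3 * s - 4 * s ^ 3 = s * (3 - 4 * s ^ 2) := by ring
      have h3 : 2 ≤ 3 - 4 * s ^ 2 := by
        have := abs_lt.1 h1
        nlinarith [this.1, this.2]
      rw [h2, abs_mul, abs_of_nonneg (by linarith : 0 ≤ 3 - 4 * s ^ 2)]
      calc 2 ^ (m + 1) * |Real.sin θ| = 2 * (2 ^ m * |Real.sin θ|) := by ring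
        _ ≤ 2 * |s| := by linarith
        _ ≤ |s| * (3 - 4 * s ^ 2) := by nlinarith [abs_nonneg s]
  have hpos := abs_pos.2 h
  obtain ⟨m, hm⟩ := pow_unbounded_of_one_lt (1 / |Real.sin θ|) (one_lt_two (α := ℝ))
  rw [div_lt_iff₀ hpos] at hm
  linarith [hgrow m, hcon m]

/-- The points `4πi/(2n+1)` at which the masses are placed. -/
def node (n i : ℕ) : ℝ := 4 * Real.pi * i / (2 * n + 1)

theorem node_zero (n : ℕ) : node n 0 = 0 := by simp [node]

theorem node_lt_node (n : ℕ) {i j : ℕ} (h : i < j) : node n i < node n j := by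
  unfold node
  have := Real.pi_pos
  have h' : (i : ℝ) < j := by exact_mod_cast h
  gcongr

theorem node_le_node (n : ℕ) {i j : ℕ} (h : i ≤ j) : node n i ≤ node n j := by
  rcases h.eq_or_lt with rfl | h
  · exact le_rfl
  · exact (node_lt_node n h).le

theorem node_lt_two_pi {n i : ℕ} (h : i ≤ n) : node n i < 2 * Real.pi := by
  unfold node
  have := Real.pi_pos
  have h' : (i : ℝ) ≤ n := by exact_mod_cast h
  rw [div_lt_iff₀ (by positivity)]
  nlinarith

theorem node_nonneg (n i : ℕ) : 0 ≤ node n i := by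
  have := Real.pi_pos
  unfold node; positivity

/-- For these orders `(k + 1/2) * node n i` is a multiple of `2π`, so the oscillating factor does
not depend on `i`, and the other factor is positive for nodes to the right of `x`. -/
theorem dirichlet_node {n i q k : ℕ} (hk : 2 * k + 1 = (2 * n + 1) * q) {x : ℝ}
    (h0 : 0 < node n i - x) (h1 : node n i - x < 2 * Real.pi) :
    dirichlet k (x - node n i) = -Real.sin (q * ((2 * n + 1) * x / 2)) *
      (1 / (2 * Real.sin ((node n i - x) / 2))) := by
  have hs : 0 < Real.sin ((node n i - x) / 2) :=
    Real.sin_pos_of_pos_of_lt_pi (by linarith) (by linarith)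
  have h := two_sin_mul_dirichlet k (x - node n i)
  have hk' : (2 * k + 1 : ℝ) = (2 * n + 1) * q := by exact_mod_cast hk
  have e1 : ((k : ℝ) + 1 / 2) * (x - node n i) =
      q * ((2 * n + 1) * x / 2) - (q * i : ℕ) * (2 * Real.pi) := by
    have h2 : (k : ℝ) + 1 / 2 = (2 * n + 1) * q / 2 := by linarith
    rw [h2, node]
    have : (2 * n + 1 : ℝ) ≠ 0 := by positivity
    push_cast
    field_simp
    ring
  have e2 : (x - node n i) / 2 = -((node n i - x) / 2) := by ring
  rw [e1, Real.sin_sub_nat_mul_two_pi, e2, Real.sin_neg] at h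
  rw [← h]
  field_simp

theorem le_abs_sum_dirichlet {n j q k : ℕ} (hk : 2 * k + 1 = (2 * n + 1) * q)
    {x : ℝ} (hx0 : node n j < x) (hx1 : x < node n (j + 1)) :
    |Real.sin (q * ((2 * n + 1) * x / 2))| *
      (n / (2 * Real.pi) * ∑ s ∈ Finset.range (n - j), 1 / ((s : ℝ) + 1)) ≤
      |∑ i ∈ Finset.Ico (j + 1) (n + 1), dirichlet k (x - node n i)| := by
  have hpi := Real.pi_pos
  have hpos : ∀ i ∈ Finset.Ico (j + 1) (n + 1), 0 < node n i - x := fun i hi => by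
    have := node_le_node n (Finset.mem_Ico.1 hi).1
    linarith
  have hlt : ∀ i ∈ Finset.Ico (j + 1) (n + 1), node n i - x < 2 * Real.pi := fun i hi => by
    have := node_lt_two_pi (n := n) (i := i) (by have := (Finset.mem_Ico.1 hi).2; omega)
    linarith [node_nonneg n j]
  rw [Finset.sum_congr rfl fun i hi => dirichlet_node hk (hpos i hi) (hlt i hi),
    ← Finset.mul_sum, abs_mul, abs_neg]
  refine mul_le_mul_of_nonneg_left ?_ (abs_nonneg _)
  refine le_trans ?_ (le_abs_self _)
  rw [Finset.mul_sum, Finset.sum_Ico_eq_sum_range]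
  have e : n + 1 - (j + 1) = n - j := by omega
  rw [e]
  refine Finset.sum_le_sum fun s hs => ?_
  have hmem : j + 1 + s ∈ Finset.Ico (j + 1) (n + 1) := by
    have := Finset.mem_range.1 hs
    rw [Finset.mem_Ico]; omega
  have h0 := hpos _ hmem
  have h1 := hlt _ hmem
  have hsin : 0 < Real.sin ((node n (j + 1 + s) - x) / 2) :=
    Real.sin_pos_of_pos_of_lt_pi (by linarith) (by linarith)
  -- By `sin u ≤ u` and `x > node n j`, the denominator is at most the distance from `node n j`,
  -- which is `s + 1` node gaps.
  have hle : 2 * Real.sin ((node n (j + 1 + s) - x) / 2) ≤ 4 * Real.pi * (s + 1) / (2 * n + 1) := by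
    have h2 := Real.sin_le (by linarith : 0 ≤ (node n (j + 1 + s) - x) / 2)
    have h3 : node n (j + 1 + s) - node n j = 4 * Real.pi * (s + 1) / (2 * n + 1) := by
      unfold node; push_cast; ring
    linarith
  calc (n : ℝ) / (2 * Real.pi) * (1 / (s + 1)) ≤ 1 / (4 * Real.pi * (s + 1) / (2 * n + 1)) := by
        rw [one_div_div, div_mul_div_comm, div_le_div_iff₀ (by positivity) (by positivity)]
        nlinarith [mul_pos hpi (by positivity : (0 : ℝ) < s + 1)]
    _ ≤ _ := by
        apply one_div_le_one_div_of_le _ hle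
        positivity

/-- From some order `Q` on, localization bounds the contribution of `f` by `π C + 1`. Among the
orders with `2k+1 = (2n+1) * 3^m * (2Q+1)`, all at least `Q`, one has oscillating factor at least
`1/2`; this turns `n/(2π)` into `n/(4π)`. -/
theorem ae_exists_lt_abs {f : ℝ → ℝ} (hf : IsGrid f) {n j : ℕ} (hj : j < n) {w M C : ℝ}
    (hw : 0 < w) (hC : ∀ x, node n j < x → x < node n (j + 1) → |f x| ≤ C)
    (hbig : M + Real.pi * C + 1 < w * (n / (4 * Real.pi) *
      ∑ s ∈ Finset.range (n - j), 1 / ((s : ℝ) + 1))) :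
    ∀ᵐ x, x ∈ Set.Ioo (node n j) (node n (j + 1)) → ∃ k : ℕ, M <
      |dirInt f k x + w * ∑ i ∈ Finset.Ico (j + 1) (n + 1), dirichlet k (x - node n i)| := by
  have hpi := Real.pi_pos
  -- Off this countable set no sine of an odd multiple of `(2n+1)x/2` vanishes, whatever `Q` turns
  -- out to be.
  have hgen : ∀ᵐ x : ℝ, x ∉ Set.range (fun p : ℤ × ℕ => 2 * (p.1 * Real.pi) / (p.2 : ℝ)) :=
    (Set.countable_range _).ae_notMem volume
  filter_upwards [hgen, hf.ae_eventually_eq] with x hx hloc hxI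
  have hx0 : 0 < x := (node_nonneg n j).trans_lt hxI.1
  have hx1 : x < 2 * Real.pi := hxI.2.trans (node_lt_two_pi hj)
  have hlim := tendsto_dirInt hf.intOn hx0 hx1 (hloc hx0)
  have hev : ∀ᶠ k in atTop, |dirInt f k x| < Real.pi * C + 1 := by
    refine hlim.abs.eventually (gt_mem_nhds ?_)
    rw [abs_mul, abs_of_pos hpi]
    nlinarith [hC x hxI.1 hxI.2]
  obtain ⟨Q, hQ⟩ := eventually_atTop.1 hev
  have hsin : Real.sin ((2 * Q + 1 : ℕ) * ((2 * n + 1) * x / 2)) ≠ 0 := by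
    intro h
    obtain ⟨l, hl⟩ := Real.sin_eq_zero_iff.1 h
    refine hx ⟨(l, (2 * Q + 1) * (2 * n + 1)), ?_⟩
    simp only
    rw [hl]
    push_cast
    field_simp
  obtain ⟨m, hm⟩ := exists_pow_three_half_le_abs_sin hsin
  have hodd : Odd ((2 * n + 1) * (3 ^ m * (2 * Q + 1))) := by
    refine Odd.mul ⟨n, rfl⟩ (Odd.mul (Odd.pow ⟨1, rfl⟩) ⟨Q, rfl⟩)
  obtain ⟨k, hk⟩ := hodd
  have hQk : Q ≤ k := by
    have h1 : 1 ≤ 3 ^ m := Nat.one_le_pow _ _ (by norm_num)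
    have h2 : 2 * Q + 1 ≤ 3 ^ m * (2 * Q + 1) := Nat.le_mul_of_pos_left _ h1
    have h3 : 3 ^ m * (2 * Q + 1) ≤ (2 * n + 1) * (3 ^ m * (2 * Q + 1)) :=
      Nat.le_mul_of_pos_left _ (by omega)
    omega
  refine ⟨k, ?_⟩
  have hk1 := hQ k hQk
  have hk2 := le_abs_sum_dirichlet (q := 3 ^ m * (2 * Q + 1)) hk.symm hxI.1 hxI.2
  set S := ∑ i ∈ Finset.Ico (j + 1) (n + 1), dirichlet k (x - node n i) with hS
  set H := ∑ s ∈ Finset.range (n - j), 1 / ((s : ℝ) + 1) with hH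
  have hH0 : 0 ≤ H := Finset.sum_nonneg fun _ _ => by positivity
  have e : (((3 ^ m * (2 * Q + 1) : ℕ) : ℝ)) * ((2 * n + 1) * x / 2) =
      3 ^ m * ((2 * Q + 1 : ℕ) * ((2 * n + 1) * x / 2)) := by push_cast; ring
  rw [e] at hk2
  have h3 : 1 / 2 * (n / (2 * Real.pi) * H) ≤ |S| :=
    le_trans (mul_le_mul_of_nonneg_right hm (by positivity)) hk2
  have h4 : w * (n / (4 * Real.pi) * H) ≤ |w * S| := by
    rw [abs_mul, abs_of_pos hw]
    refine mul_le_mul_of_nonneg_left (le_of_eq_of_le ?_ h3) hw.le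
    field_simp
    ring
  have h5 : |w * S| ≤ |dirInt f k x + w * S| + |dirInt f k x| := by
    have := abs_sub (dirInt f k x + w * S) (dirInt f k x)
    rwa [add_sub_cancel_left] at this
  linarith

/-- Bounded-order version of an almost everywhere statement. -/
theorem exists_volume_le {A : ℕ → ℝ → ℝ} (hA : ∀ k, Continuous (A k)) {a b M : ℝ}
    (h : ∀ᵐ x, x ∈ Set.Ioo a b → ∃ k, M < |A k x|) {η : ENNReal} (hη : 0 < η) :
    ∃ K₀ : ℕ, ∀ K ≥ K₀, volume {x | x ∈ Set.Ioo a b ∧ ∀ k ≤ K, |A k x| ≤ M} ≤ η := by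
  set E : ℕ → Set ℝ := fun K => {x | x ∈ Set.Ioo a b ∧ ∀ k ≤ K, |A k x| ≤ M} with hE
  have hEm : ∀ K, MeasurableSet (E K) := by
    intro K
    have : E K = Set.Ioo a b ∩ ⋂ k, ⋂ (_ : k ≤ K), {x | |A k x| ≤ M} := by
      ext x; simp [hE]
    rw [this]
    exact measurableSet_Ioo.inter (MeasurableSet.iInter fun k => MeasurableSet.iInter fun _ =>
      (isClosed_le (hA k).abs continuous_const).measurableSet)
  have hanti : Antitone E := fun K K' hK x hx => ⟨hx.1, fun k hk => hx.2 k (hk.trans hK)⟩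
  have hlim := tendsto_measure_iInter_atTop (μ := volume) (fun K => (hEm K).nullMeasurableSet)
    hanti ⟨0, (measure_mono (fun x hx => hx.1)).trans_lt (measure_Ioo_lt_top (a := a) (b := b)) |>.ne⟩
  have hz : volume (⋂ K, E K) = 0 := by
    refine measure_mono_null ?_ h
    intro x hx
    rw [Set.mem_iInter] at hx
    intro hcon
    obtain ⟨k, hk⟩ := hcon (hx 0).1
    exact absurd ((hx k).2 k le_rfl) (not_le.2 hk)
  rw [hz] at hlim
  obtain ⟨K₀, hK₀⟩ := eventually_atTop.1 (hlim.eventually (gt_mem_nhds hη))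
  exact ⟨K₀, fun K hK => (hK₀ K hK).le⟩

/-- At stage `j` the first `j` masses have become bumps and the others are still ideal point masses.
Each replacement lowers the threshold by `1/n`, hence `M + 1 - j/n`, and each interval treated adds
`η` to the exceptional measure. Only the first `J` intervals are treated, since further right too
few masses remain for a large harmonic sum. -/
theorem kolmogorov_stage {ψ : ℝ → ℝ} (hψ : IsGrid ψ) {C : ℝ}
    (hC : ∀ t ≤ 2 * Real.pi, |ψ t| ≤ C) {n J : ℕ} (hJ : J ≤ n) {w : ℚ} (hw : 0 < w) {M η : ℝ}
    (hη : 0 < η) (hbig : M + 1 + Real.pi * C + 1 < w * (n / (4 * Real.pi) *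
      ∑ s ∈ Finset.range (n - J), 1 / ((s : ℝ) + 1))) (j : ℕ) (hj : j ≤ n) :
    ∃ f : ℝ → ℝ, IsGrid f ∧ (∀ t, node n j ≤ t → f t = ψ t) ∧
      nrm (fun t => f t - ψ t) ≤ j * w ∧
      ∃ K : ℕ, volume {x | x ∈ Set.Ioo 0 (node n (min j J)) ∧ ∀ k ≤ K,
        |dirInt f k x + w * ∑ i ∈ Finset.Ico (j + 1) (n + 1), dirichlet k (x - node n i)|
          ≤ M + 1 - j / n} ≤ ENNReal.ofReal (j * η) := by
  have hw' : (0 : ℝ) < w := by exact_mod_cast hw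
  induction j with
  | zero =>
    refine ⟨ψ, hψ, fun _ _ => rfl, by simp [nrm], 0, ?_⟩
    simp [node_zero]
  | succ j ih =>
    obtain ⟨f, hf, hfψ, hnrm, K, hK⟩ := ih (by omega)
    have hn0 : (0 : ℝ) < n := by
      have : 0 < n := by omega
      exact_mod_cast this
    set A : ℕ → ℝ → ℝ := fun k x =>
      dirInt f k x + w * ∑ i ∈ Finset.Ico (j + 1) (n + 1), dirichlet k (x - node n i) with hA
    have hAc : ∀ k, Continuous (A k) := by
      intro k
      refine (continuous_dirInt hf.intOn k).add (continuous_const.mul ?_)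
      exact continuous_finsetSum _ fun i _ => (continuous_dirichlet k).comp (by fun_prop)
    -- The order bound is enlarged to cover the next interval before the mass at its right end is
    -- touched. For `j ≥ J` there is no new interval.
    obtain ⟨K', hKK', hK'⟩ : ∃ K' ≥ K, volume {x | x ∈ Set.Ioo 0 (node n (min (j + 1) J)) ∧
        ∀ k ≤ K', |A k x| ≤ M + 1 - j / n} ≤ ENNReal.ofReal ((j + 1 : ℕ) * η) := by
      rcases lt_or_ge j J with hjJ | hjJ
      · have hsum : ∑ s ∈ Finset.range (n - J), 1 / ((s : ℝ) + 1) ≤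
            ∑ s ∈ Finset.range (n - j), 1 / ((s : ℝ) + 1) :=
          Finset.sum_le_sum_of_subset_of_nonneg (Finset.range_mono (by omega))
            fun _ _ _ => by positivity
        have hae := ae_exists_lt_abs hf (by omega : j < n) hw' (M := M + 1) (C := C)
          (fun x h0 h1 => by
            rw [hfψ x h0.le]
            exact hC x (h1.le.trans (node_lt_two_pi hj).le))
          (hbig.trans_le (by have := Real.pi_pos; gcongr))
        obtain ⟨K₀, hK₀⟩ := exists_volume_le hAc hae (ENNReal.ofReal_pos.2 hη)
        refine ⟨max K K₀, le_max_left _ _, ?_⟩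
        have h2 := hK₀ (max K K₀) (le_max_right _ _)
        rw [min_eq_left hjJ.le] at hK
        rw [min_eq_left (by omega : j + 1 ≤ J)]
        have hsub : {x | x ∈ Set.Ioo 0 (node n (j + 1)) ∧
            ∀ k ≤ max K K₀, |A k x| ≤ M + 1 - j / n} ⊆
            ({x | x ∈ Set.Ioo 0 (node n j) ∧ ∀ k ≤ K, |A k x| ≤ M + 1 - j / n} ∪
            {x | x ∈ Set.Ioo (node n j) (node n (j + 1)) ∧
              ∀ k ≤ max K K₀, |A k x| ≤ M + 1}) ∪ {node n j} := by
          rintro x ⟨⟨hx0, hx1⟩, hx⟩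
          rcases lt_trichotomy x (node n j) with h | h | h
          · exact Or.inl (Or.inl ⟨⟨hx0, h⟩, fun k hk => hx k (hk.trans (le_max_left _ _))⟩)
          · exact Or.inr h
          · refine Or.inl (Or.inr ⟨⟨h, hx1⟩, fun k hk => (hx k hk).trans ?_⟩)
            have : (0 : ℝ) ≤ j / n := by positivity
            linarith
        refine (measure_mono hsub).trans ((measure_union_le _ _).trans ?_)
        rw [measure_singleton, add_zero]
        refine (measure_union_le _ _).trans ((add_le_add hK h2).trans (le_of_eq ?_))
        rw [← ENNReal.ofReal_add (by positivity) hη.le]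
        congr 1; push_cast; ring
      · refine ⟨K, le_rfl, ?_⟩
        rw [min_eq_right hjJ] at hK
        rw [min_eq_right (by omega : J ≤ j + 1)]
        refine hK.trans (ENNReal.ofReal_le_ofReal ?_)
        gcongr
        omega
    -- The approximation holds at all `x` for all orders up to `K'`, so the intervals done earlier
    -- lose only `1/n`. As the bump lies left of the node, the function still equals `ψ` from the
    -- node on.
    obtain ⟨b, hb, hb0, hbn, hbd⟩ := exists_bump (y := node n (j + 1))
      ((node_nonneg n j).trans_lt (node_lt_node n (Nat.lt_succ_self j))) (node_lt_two_pi hj)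
      hw K' (ε := 1 / n) (by positivity)
    refine ⟨fun t => f t + b t, hf.add hb, fun t ht => ?_, ?_, K', ?_⟩
    · simp only [hfψ t ((node_le_node n (Nat.le_succ j)).trans ht), hb0 t ht, add_zero]
    · have h1 : nrm (fun t => f t + b t - ψ t) ≤ nrm (fun t => f t - ψ t) + nrm b := by
        unfold nrm
        have i1 : IntOn (fun t => |f t - ψ t|) := (hf.intOn.sub hψ.intOn).abs
        have i2 : IntOn (fun t => |b t|) := hb.intOn.abs
        rw [← intervalIntegral.integral_add i1 i2]
        refine intervalIntegral.integral_mono Real.two_pi_pos.le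
          ((hf.add hb).intOn.sub hψ.intOn).abs (i1.add i2) fun t => ?_
        have := abs_add_le (f t - ψ t) (b t)
        rwa [show f t - ψ t + b t = f t + b t - ψ t by ring] at this
      push_cast
      rw [hbn] at h1
      linarith
    · refine (measure_mono ?_).trans hK'
      rintro x ⟨hx, hxk⟩
      refine ⟨hx, fun k hk => ?_⟩
      have h1 := hxk k hk
      have h2 := hbd k hk x
      rw [dirInt_add hf.intOn hb.intOn] at h1
      simp only [hA]
      rw [Finset.sum_eq_sum_Ico_succ_bot (by omega : j + 1 < n + 1), mul_add]
      set S := ∑ i ∈ Finset.Ico (j + 1 + 1) (n + 1), dirichlet k (x - node n i)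
      have h3 : dirInt f k x + ((w : ℝ) * dirichlet k (x - node n (j + 1)) + w * S) =
        (dirInt f k x + dirInt b k x + w * S) -
          (dirInt b k x - w * dirichlet k (x - node n (j + 1))) := by ring
      rw [h3]
      refine (abs_sub _ _).trans ?_
      have h4 : ((j + 1 : ℕ) : ℝ) / n = j / n + 1 / n := by push_cast; ring
      rw [h4] at h1
      linarith

/-- Near every grid function there is one whose partial sums are large off a small set. -/
theorem kolmogorov {ψ : ℝ → ℝ} (hψ : IsGrid ψ) {ρ : ℝ} (hρ : 0 < ρ) (M : ℝ) {η : ℝ} (hη : 0 < η) :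
    ∃ f : ℝ → ℝ, IsGrid f ∧ nrm (fun t => f t - ψ t) < ρ ∧
      ∃ L : ℕ, volume {x | x ∈ Set.Icc 0 (2 * Real.pi) ∧ ∀ k ≤ L, |dirInt f k x| ≤ M} <
        ENNReal.ofReal η := by
  have hpi := Real.pi_pos
  obtain ⟨C, hC0, hC⟩ := hψ.exists_bound
  obtain ⟨ρ', hρ'0, hρ'1⟩ := exists_rat_btwn hρ
  have hρ'2 : 0 < ρ' := by exact_mod_cast hρ'0
  -- With `w = ρ'/n` the factor `n` cancels, so the number `m` of harmonic terms needed does not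
  -- depend on `n`.
  obtain ⟨m, hm⟩ := (Real.tendsto_sum_range_one_div_nat_succ_atTop.eventually
    (eventually_gt_atTop ((M + 1 + Real.pi * C + 1) * (4 * Real.pi) / ρ'))).exists
  rw [div_lt_iff₀ hρ'0] at hm
  -- The untreated piece from `node n (n - m)` to `2π` has length `2π(2m+1)/(2n+1)`, which this
  -- makes less than `η/2`.
  obtain ⟨n, hn⟩ := exists_nat_gt (m + 1 + 2 * Real.pi * (2 * m + 1) / (η / 2))
  have hmn : m + 1 ≤ n := by
    have : ((m + 1 : ℕ) : ℝ) < n := by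
      push_cast
      exact lt_of_le_of_lt (le_add_of_nonneg_right (by positivity)) hn
    exact_mod_cast this.le
  have hn0 : (0 : ℝ) < n := by
    have : 0 < n := by omega
    exact_mod_cast this
  have hw : 0 < ρ' / n := by
    have : (0 : ℚ) < n := by exact_mod_cast hn0
    positivity
  have e1 : n - (n - m) = m := by omega
  obtain ⟨f, hf, -, hnrm, K, hK⟩ := kolmogorov_stage hψ hC (n := n) (J := n - m) (by omega) hw
    (M := M) (η := η / (4 * n)) (by positivity) (by
      rw [e1]
      push_cast
      have : (ρ' : ℝ) / n * (n / (4 * Real.pi) * ∑ s ∈ Finset.range m, 1 / ((s : ℝ) + 1)) =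
        ((∑ s ∈ Finset.range m, 1 / ((s : ℝ) + 1)) * ρ') / (4 * Real.pi) := by
        field_simp
      rw [this, lt_div_iff₀ (by positivity)]
      exact hm) n le_rfl
  refine ⟨f, hf, ?_, K, ?_⟩
  · refine lt_of_le_of_lt hnrm ?_
    push_cast
    rw [mul_div_cancel₀ _ hn0.ne']
    exact hρ'1
  · rw [min_eq_right (by omega : n - m ≤ n)] at hK
    set X := node n (n - m) with hX
    have hsub : {x | x ∈ Set.Icc 0 (2 * Real.pi) ∧ ∀ k ≤ K, |dirInt f k x| ≤ M} ⊆
        ({x | x ∈ Set.Ioo 0 X ∧ ∀ k ≤ K, |dirInt f k x + (ρ' / n : ℚ) *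
          ∑ i ∈ Finset.Ico (n + 1) (n + 1), dirichlet k (x - node n i)| ≤ M + 1 - n / n} ∪
        {0}) ∪ Set.Icc X (2 * Real.pi) := by
      rintro x ⟨⟨hx0, hx1⟩, hx⟩
      rcases le_or_gt X x with h | h
      · exact Or.inr ⟨h, hx1⟩
      · rcases hx0.eq_or_lt with h' | h'
        · exact Or.inl (Or.inr h'.symm)
        · refine Or.inl (Or.inl ⟨⟨h', h⟩, fun k hk => ?_⟩)
          rw [Finset.Ico_self, Finset.sum_empty, mul_zero, add_zero, div_self hn0.ne',
            add_sub_cancel_right]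
          exact hx k hk
    have hXlen : 2 * Real.pi - X < η / 2 := by
      have h1 : 2 * Real.pi - X = 2 * Real.pi * (2 * m + 1) / (2 * n + 1) := by
        rw [hX, node, Nat.cast_sub (by omega)]
        field_simp
        ring
      have h2 : 2 * Real.pi * (2 * m + 1) / (η / 2) < n :=
        lt_of_le_of_lt (le_add_of_nonneg_left (by positivity)) hn
      rw [div_lt_iff₀ (by positivity)] at h2
      rw [h1, div_lt_iff₀ (by positivity)]
      nlinarith
    have hX2 : 0 ≤ 2 * Real.pi - X := by
      have := node_lt_two_pi (n := n) (i := n - m) (by omega)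
      linarith
    calc _ ≤ (ENNReal.ofReal (n * (η / (4 * n))) + 0) + ENNReal.ofReal (2 * Real.pi - X) := by
          refine (measure_mono hsub).trans ((measure_union_le _ _).trans ?_)
          rw [Real.volume_Icc]
          gcongr
          refine (measure_union_le _ _).trans ?_
          rw [measure_singleton]
          gcongr
      _ < ENNReal.ofReal η := by
          rw [add_zero, ← ENNReal.ofReal_add (by positivity) hX2]
          refine (ENNReal.ofReal_lt_ofReal_iff hη).2 ?_
          have : (n : ℝ) * (η / (4 * n)) = η / 4 := by field_simp
          rw [this]
          linarith

/-! ## Primitive recursive rational-valued functions -/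

attribute [fun_prop] Primrec PrimrecPred
attribute [fun_prop] Primrec.id Primrec.const Primrec.comp Primrec.fst Primrec.snd Primrec.pair
attribute [fun_prop] PrimrecPred.and PrimrecPred.or PrimrecPred.not

section Primrec

variable {α β γ : Type*} [Primcodable α] [Primcodable β] [Primcodable γ]

@[fun_prop]
theorem primrec_fst {f : α → β × γ} (hf : Primrec f) : Primrec fun a => (f a).1 :=
  Primrec.fst.comp hf

@[fun_prop]
theorem primrec_snd {f : α → β × γ} (hf : Primrec f) : Primrec fun a => (f a).2 :=
  Primrec.snd.comp hf

@[fun_prop]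
theorem primrec_add {f g : α → ℕ} (hf : Primrec f) (hg : Primrec g) :
    Primrec fun a => f a + g a := Primrec.nat_add.comp hf hg

@[fun_prop]
theorem primrec_mul {f g : α → ℕ} (hf : Primrec f) (hg : Primrec g) :
    Primrec fun a => f a * g a := Primrec.nat_mul.comp hf hg

@[fun_prop]
theorem primrec_sub {f g : α → ℕ} (hf : Primrec f) (hg : Primrec g) :
    Primrec fun a => f a - g a := Primrec.nat_sub.comp hf hg

@[fun_prop]
theorem primrec_div {f g : α → ℕ} (hf : Primrec f) (hg : Primrec g) :
    Primrec fun a => f a / g a := Primrec.nat_div.comp hf hg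

@[fun_prop]
theorem primrec_mod {f g : α → ℕ} (hf : Primrec f) (hg : Primrec g) :
    Primrec fun a => f a % g a := Primrec.nat_mod.comp hf hg

@[fun_prop]
theorem primrec_length {f : α → List β} (hf : Primrec f) :
    Primrec fun a => (f a).length := Primrec.list_length.comp hf

@[fun_prop]
theorem primrec_getD {f : α → List β} {g : α → ℕ} {d : β} (hf : Primrec f) (hg : Primrec g) :
    Primrec fun a => (f a).getD (g a) d := (Primrec.list_getD d).comp hf hg

@[fun_prop]
theorem primrec_ite {P : α → Prop} [DecidablePred P] {f g : α → β} (hP : PrimrecPred P)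
    (hf : Primrec f) (hg : Primrec g) : Primrec fun a => if P a then f a else g a :=
  Primrec.ite hP hf hg

@[fun_prop]
theorem primrecPred_nat_le {f g : α → ℕ} (hf : Primrec f) (hg : Primrec g) :
    PrimrecPred fun a => f a ≤ g a := Primrec.nat_le.comp hf hg

@[fun_prop]
theorem primrecPred_eq {f g : α → β} (hf : Primrec f) (hg : Primrec g) :
    PrimrecPred fun a => f a = g a := Primrec.eq.comp hf hg

@[fun_prop]
theorem primrecPred_forall_lt {m : α → ℕ} {R : α → ℕ → Prop} (hm : Primrec m)
    (hR : PrimrecPred fun p : α × ℕ => R p.1 p.2) : PrimrecPred fun a => ∀ k < m a, R a k := by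
  have h : PrimrecRel fun (k : ℕ) (a : α) => R a k :=
    hR.comp (Primrec.pair Primrec.snd Primrec.fst)
  exact (h.forall_mem_list.comp (Primrec.list_range.comp hm) Primrec.id).of_eq fun a => by simp

theorem primrec_int_encode : Primrec Equiv.intEquivNat :=
  (Primrec.encode (α := ℤ)).of_eq fun _ => rfl

/-- The parity of the code of an integer is its sign: nonnegative `n` has code `2n`, and `-(n+1)`
has code `2n+1`. -/
theorem primrec_toNat : Primrec Int.toNat := by
  have h : Primrec fun z : ℤ => if Equiv.intEquivNat z % 2 = 0 then Equiv.intEquivNat z / 2 else 0 := by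
    have := primrec_int_encode
    fun_prop
  refine h.of_eq fun z => ?_
  rcases z with n | n
  · have : Equiv.intEquivNat (Int.ofNat n) = 2 * n := rfl
    rw [this]; simp
  · have : Equiv.intEquivNat (Int.negSucc n) = 2 * n + 1 := rfl
    rw [this]
    simp [Nat.add_mod]

theorem primrec_toNat_neg : Primrec fun z : ℤ => (-z).toNat := by
  have h : Primrec fun z : ℤ =>
      if Equiv.intEquivNat z % 2 = 0 then 0 else Equiv.intEquivNat z / 2 + 1 := by
    have := primrec_int_encode
    fun_prop
  refine h.of_eq fun z => ?_
  rcases z with n | n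
  · have : Equiv.intEquivNat (Int.ofNat n) = 2 * n := rfl
    rw [this]; simp
  · have : Equiv.intEquivNat (Int.negSucc n) = 2 * n + 1 := rfl
    rw [this, if_neg (by omega), Int.neg_negSucc]
    omega

theorem primrec_natCast_int : Primrec fun n : ℕ => (n : ℤ) := by
  have h : Primrec fun n : ℕ => Equiv.intEquivNat (n : ℤ) :=
    (show Primrec fun n : ℕ => 2 * n by fun_prop).of_eq fun n => rfl
  exact Primrec.encode_iff.1 (h.of_eq fun _ => rfl)

/-- `(p, n, d)` stands for the rational number `(p - n) / (d + 1)`. -/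
def fracVal (s : ℕ × ℕ × ℕ) : ℚ := ((s.1 : ℚ) - s.2.1) / (s.2.2 + 1)

/-- Rational-valued functions with primitive recursive numerator and denominator. -/
@[fun_prop]
def PrimrecRat (f : α → ℚ) : Prop := ∃ g : α → ℕ × ℕ × ℕ, Primrec g ∧ ∀ a, fracVal (g a) = f a

/-- The last entry is `(d+1)(d'+1) - 1`. Fractions are never reduced and signs are kept as
differences, so all arithmetic is polynomial in natural numbers. -/
def fracAdd (s t : ℕ × ℕ × ℕ) : ℕ × ℕ × ℕ :=
  (s.1 * (t.2.2 + 1) + t.1 * (s.2.2 + 1), s.2.1 * (t.2.2 + 1) + t.2.1 * (s.2.2 + 1),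
    s.2.2 * t.2.2 + s.2.2 + t.2.2)

def fracMul (s t : ℕ × ℕ × ℕ) : ℕ × ℕ × ℕ :=
  (s.1 * t.1 + s.2.1 * t.2.1, s.1 * t.2.1 + s.2.1 * t.1, s.2.2 * t.2.2 + s.2.2 + t.2.2)

theorem fracVal_add (s t : ℕ × ℕ × ℕ) : fracVal (fracAdd s t) = fracVal s + fracVal t := by
  have h1 : (s.2.2 : ℚ) + 1 ≠ 0 := by positivity
  have h2 : (t.2.2 : ℚ) + 1 ≠ 0 := by positivity
  have h3 : (s.2.2 : ℚ) * t.2.2 + s.2.2 + t.2.2 + 1 = (s.2.2 + 1) * (t.2.2 + 1) := by ring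
  simp only [fracVal, fracAdd]
  push_cast
  rw [h3]
  field_simp
  ring

theorem fracVal_mul (s t : ℕ × ℕ × ℕ) : fracVal (fracMul s t) = fracVal s * fracVal t := by
  have h3 : (s.2.2 : ℚ) * t.2.2 + s.2.2 + t.2.2 + 1 = (s.2.2 + 1) * (t.2.2 + 1) := by ring
  simp only [fracVal, fracMul]
  push_cast
  rw [h3]
  field_simp
  ring

@[fun_prop]
theorem primrec_fracAdd {f g : α → ℕ × ℕ × ℕ} (hf : Primrec f) (hg : Primrec g) :
    Primrec fun a => fracAdd (f a) (g a) := by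
  unfold fracAdd; fun_prop

@[fun_prop]
theorem primrec_fracMul {f g : α → ℕ × ℕ × ℕ} (hf : Primrec f) (hg : Primrec g) :
    Primrec fun a => fracMul (f a) (g a) := by
  unfold fracMul; fun_prop

@[fun_prop]
theorem PrimrecRat.const (q : ℚ) : PrimrecRat fun _ : α => q := by
  refine ⟨fun _ => (q.num.toNat, (-q.num).toNat, q.den - 1), by fun_prop, fun _ => ?_⟩
  have h1 : ((q.num.toNat : ℚ) - (-q.num).toNat) = q.num := by
    have := Int.toNat_sub_toNat_neg q.num
    exact_mod_cast this
  have h2 : ((q.den - 1 : ℕ) : ℚ) + 1 = q.den := by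
    have := q.den_pos
    rw [Nat.cast_sub this]; simp
  simp only [fracVal]
  rw [h1, h2, Rat.num_div_den]

@[fun_prop]
theorem PrimrecRat.natCast {f : α → ℕ} (hf : Primrec f) : PrimrecRat fun a => (f a : ℚ) :=
  ⟨fun a => (f a, 0, 0), by fun_prop, fun a => by simp [fracVal]⟩

@[fun_prop]
theorem PrimrecRat.natCast_inv {f : α → ℕ} (hf : Primrec f) :
    PrimrecRat fun a => ((f a : ℚ))⁻¹ := by
  -- The numerator `0` at `f a = 0` matches the convention `0⁻¹ = 0`.
  refine ⟨fun a => (if f a = 0 then 0 else 1, 0, f a - 1), by fun_prop, fun a => ?_⟩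
  simp only [fracVal]
  rcases Nat.eq_zero_or_pos (f a) with h | h
  · simp [h]
  · rw [if_neg h.ne', Nat.cast_sub h]; simp

@[fun_prop]
theorem PrimrecRat.ratVal {f : α → ℤ × ℕ} (hf : Primrec f) :
    PrimrecRat fun a => ratVal (f a) := by
  refine ⟨fun a => ((f a).1.toNat, (-(f a).1).toNat, (f a).2), ?_, fun a => ?_⟩
  · have h1 := primrec_toNat
    have h2 := primrec_toNat_neg
    exact (h1.comp (Primrec.fst.comp hf)).pair
      ((h2.comp (Primrec.fst.comp hf)).pair (Primrec.snd.comp hf))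
  · have h1 : (((f a).1.toNat : ℚ) - (-(f a).1).toNat) = (f a).1 := by
      have := Int.toNat_sub_toNat_neg (f a).1
      exact_mod_cast this
    simp only [fracVal, LOneRec.ratVal]
    rw [h1]

@[fun_prop]
theorem PrimrecRat.add {f g : α → ℚ} (hf : PrimrecRat f) (hg : PrimrecRat g) :
    PrimrecRat fun a => f a + g a := by
  obtain ⟨f', hf, hf'⟩ := hf
  obtain ⟨g', hg, hg'⟩ := hg
  exact ⟨fun a => fracAdd (f' a) (g' a), by fun_prop, fun a => by rw [fracVal_add, hf', hg']⟩

@[fun_prop]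
theorem PrimrecRat.mul {f g : α → ℚ} (hf : PrimrecRat f) (hg : PrimrecRat g) :
    PrimrecRat fun a => f a * g a := by
  obtain ⟨f', hf, hf'⟩ := hf
  obtain ⟨g', hg, hg'⟩ := hg
  exact ⟨fun a => fracMul (f' a) (g' a), by fun_prop, fun a => by rw [fracVal_mul, hf', hg']⟩

@[fun_prop]
theorem PrimrecRat.neg {f : α → ℚ} (hf : PrimrecRat f) : PrimrecRat fun a => -f a := by
  obtain ⟨f', hf, hf'⟩ := hf
  refine ⟨fun a => ((f' a).2.1, (f' a).1, (f' a).2.2), by fun_prop, fun a => ?_⟩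
  simp only [← hf', fracVal]; ring

@[fun_prop]
theorem PrimrecRat.sub {f g : α → ℚ} (hf : PrimrecRat f) (hg : PrimrecRat g) :
    PrimrecRat fun a => f a - g a := by
  simp_rw [sub_eq_add_neg]; fun_prop

@[fun_prop]
theorem PrimrecRat.div_natCast {f : α → ℚ} {g : α → ℕ} (hf : PrimrecRat f) (hg : Primrec g) :
    PrimrecRat fun a => f a / (g a : ℚ) := by
  simp_rw [div_eq_mul_inv]; fun_prop

@[fun_prop]
theorem PrimrecRat.ite {P : α → Prop} [DecidablePred P] {f g : α → ℚ} (hP : PrimrecPred P)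
    (hf : PrimrecRat f) (hg : PrimrecRat g) : PrimrecRat fun a => if P a then f a else g a := by
  obtain ⟨f', hf, hf'⟩ := hf
  obtain ⟨g', hg, hg'⟩ := hg
  refine ⟨fun a => if P a then f' a else g' a, by fun_prop, fun a => ?_⟩
  beta_reduce
  split_ifs
  · exact hf' a
  · exact hg' a

@[fun_prop]
theorem PrimrecRat.le {f g : α → ℚ} (hf : PrimrecRat f) (hg : PrimrecRat g) :
    PrimrecPred fun a => f a ≤ g a := by
  obtain ⟨f', hf, hf'⟩ := hf
  obtain ⟨g', hg, hg'⟩ := hg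
  have h : PrimrecPred fun a => (f' a).1 * ((g' a).2.2 + 1) + (g' a).2.1 * ((f' a).2.2 + 1) ≤
      (g' a).1 * ((f' a).2.2 + 1) + (f' a).2.1 * ((g' a).2.2 + 1) := by fun_prop
  refine h.of_eq fun a => ?_
  rw [← hf', ← hg']
  simp only [fracVal]
  rw [div_le_div_iff₀ (by positivity) (by positivity), ← Nat.cast_le (α := ℚ)]
  push_cast
  constructor <;> intro h <;> linarith

@[fun_prop]
theorem PrimrecRat.lt {f g : α → ℚ} (hf : PrimrecRat f) (hg : PrimrecRat g) :
    PrimrecPred fun a => f a < g a := by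
  simp_rw [← not_le]; fun_prop

@[fun_prop]
theorem PrimrecRat.eq {f g : α → ℚ} (hf : PrimrecRat f) (hg : PrimrecRat g) :
    PrimrecPred fun a => f a = g a := by
  simp_rw [le_antisymm_iff]; fun_prop

@[fun_prop]
theorem PrimrecRat.abs {f : α → ℚ} (hf : PrimrecRat f) : PrimrecRat fun a => |f a| := by
  have h : PrimrecRat fun a => if f a ≤ 0 then -f a else f a := by fun_prop
  convert! h using 2 with a
  split_ifs with h
  · exact abs_of_nonpos h
  · exact abs_of_pos (not_le.1 h)

@[fun_prop]
theorem primrec_prod_range {m : α → ℕ} {f : α → ℕ → ℕ} (hm : Primrec m)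
    (hf : Primrec fun p : α × ℕ => f p.1 p.2) :
    Primrec fun a => ∏ j ∈ Finset.range (m a), f a j := by
  have h : Primrec fun a => (Nat.rec 1 (fun j s => s * f a j) (m a) : ℕ) := by
    refine Primrec.nat_rec' (h := fun a p => p.2 * f a p.1) hm (Primrec.const 1) ?_
    have h1 : Primrec fun q : α × ℕ × ℕ => f q.1 q.2.1 :=
      hf.comp (show Primrec fun q : α × ℕ × ℕ => (q.1, q.2.1) by fun_prop)
    exact Primrec.nat_mul.comp (show Primrec fun q : α × ℕ × ℕ => q.2.2 by fun_prop) h1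
  refine h.of_eq fun a => ?_
  induction m a with
  | zero => simp
  | succ j ih => simp only [ih, Finset.prod_range_succ]

theorem primrec_rec_fold {m : α → ℕ} (hm : Primrec m) {f : α × ℕ → ℕ × ℕ × ℕ} (hf : Primrec f)
    (b : ℕ × ℕ × ℕ) {op : ℕ × ℕ × ℕ → ℕ × ℕ × ℕ → ℕ × ℕ × ℕ}
    (hop : Primrec fun p : (ℕ × ℕ × ℕ) × (ℕ × ℕ × ℕ) => op p.1 p.2) :
    Primrec fun a => (Nat.rec b (fun j s => op s (f (a, j))) (m a) : ℕ × ℕ × ℕ) := by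
  refine Primrec.nat_rec' (h := fun a p => op p.2 (f (a, p.1))) hm (Primrec.const b) ?_
  have : Primrec fun q : α × ℕ × (ℕ × ℕ × ℕ) => (q.2.2, f (q.1, q.2.1)) := by fun_prop
  exact hop.comp this

@[fun_prop]
theorem PrimrecRat.sum_range {m : α → ℕ} {f : α → ℕ → ℚ} (hm : Primrec m)
    (hf : PrimrecRat fun p : α × ℕ => f p.1 p.2) :
    PrimrecRat fun a => ∑ j ∈ Finset.range (m a), f a j := by
  obtain ⟨f', hf, hf'⟩ := hf
  refine ⟨_, primrec_rec_fold hm hf (0, 0, 0) (op := fracAdd) (by fun_prop), fun a => ?_⟩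
  beta_reduce
  induction m a with
  | zero => simp [fracVal]
  | succ j ih => rw [fracVal_add, ih, Finset.sum_range_succ, hf']

@[fun_prop]
theorem PrimrecRat.prod_range {m : α → ℕ} {f : α → ℕ → ℚ} (hm : Primrec m)
    (hf : PrimrecRat fun p : α × ℕ => f p.1 p.2) :
    PrimrecRat fun a => ∏ j ∈ Finset.range (m a), f a j := by
  obtain ⟨f', hf, hf'⟩ := hf
  refine ⟨_, primrec_rec_fold hm hf (1, 0, 0) (op := fracMul) (by fun_prop), fun a => ?_⟩
  beta_reduce
  induction m a with
  | zero => simp [fracVal]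
  | succ j ih => rw [fracVal_mul, ih, Finset.prod_range_succ, hf']

end Primrec

/-! ## The search predicates -/

/-- Lower bounds for `2π` from Wallis' product. -/
def piLo (k : ℕ) : ℚ :=
  4 * ∏ i ∈ Finset.range k, (((2 * i + 2 : ℕ) : ℚ) / ((2 * i + 1 : ℕ) : ℚ) *
    (((2 * i + 2 : ℕ) : ℚ) / ((2 * i + 3 : ℕ) : ℚ)))

/-- Upper bounds for `2π` from Wallis' product. -/
def piHi (k : ℕ) : ℚ := piLo k * (((2 * k + 2 : ℕ) : ℚ) / ((2 * k + 1 : ℕ) : ℚ))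

/-- Codes for lists of endpoints. -/
abbrev ListCode : Type := List ((ℤ × ℕ) × (ℤ × ℕ))

/-- The value at `x` of the step function with the given endpoints. -/
def stepVal (l : ListCode) (x : ℚ) : ℚ :=
  ∑ i ∈ Finset.range (l.length - 1),
    if ratVal (l.getD i ((0, 0), (0, 0))).1 ≤ x ∧ x < ratVal (l.getD (i + 1) ((0, 0), (0, 0))).1
    then ratVal (l.getD i ((0, 0), (0, 0))).2 else 0

/-- A common denominator of the break points. -/
def commonDen (l : ListCode) : ℕ :=
  ∏ i ∈ Finset.range l.length, ((l.getD i ((0, 0), (0, 0))).1.2 + 1)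

/-- The `j`-th rational number in a list of codes. -/
def listVal (v : List (ℤ × ℕ)) (j : ℕ) : ℚ := ratVal (v.getD j (0, 0))

/-- Taylor polynomials of the cosine. -/
def cosTaylor (T : ℕ) (y : ℚ) : ℚ :=
  ∑ s ∈ Finset.range T, ∏ i ∈ Finset.range s, -(y * y) / ((2 * i + 1) * (2 * i + 2) : ℕ)

/-- The error of `cosTaylor T` on `[-Y, Y]`. -/
def cosErr (T : ℕ) (Y : ℚ) : ℚ := 2 * ∏ i ∈ Finset.range (2 * T), Y / ((i + 1 : ℕ) : ℚ)

/-- Rational approximation of the Dirichlet kernel. -/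
def dirichletTaylor (T k : ℕ) (y : ℚ) : ℚ :=
  1 / 2 + ∑ m ∈ Finset.range k, cosTaylor T (((m + 1 : ℕ) : ℚ) * y)

/-- Rational approximation of `dirInt` at the point `i/N` for a grid function. -/
def riemannSum (N : ℕ) (v : List (ℤ × ℕ)) (T k i : ℕ) : ℚ :=
  (∑ j ∈ Finset.range v.length,
    listVal v j * dirichletTaylor T k (((i : ℚ) - (j : ℚ)) / (N : ℚ))) / (N : ℚ)

/-- The norm of a grid function. -/
def gridNorm (N : ℕ) (v : List (ℤ × ℕ)) (J : ℕ) : ℚ :=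
  (∑ j ∈ Finset.range J, |listVal v j|) / (N : ℚ)

/-- A certificate: the grid `N`, the values, the reciprocal `s + 1` of the new radius, the maximal
order `L`, the Taylor degree `T`, the index `w` of a bound for `2π`, and a number `J` of cells
that cover `[0,2π]`. -/
structure Cert where
  N : ℕ
  v : List (ℤ × ℕ)
  s : ℕ
  L : ℕ
  T : ℕ
  w : ℕ
  J : ℕ

/-- Certificates are tuples. -/
def Cert.equiv : Cert ≃ ℕ × List (ℤ × ℕ) × ℕ × ℕ × ℕ × ℕ × ℕ where
  toFun t := (t.N, t.v, t.s, t.L, t.T, t.w, t.J)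
  invFun p := ⟨p.1, p.2.1, p.2.2.1, p.2.2.2.1, p.2.2.2.2.1, p.2.2.2.2.2.1, p.2.2.2.2.2.2⟩
  left_inv _ := rfl
  right_inv _ := rfl

instance : Primcodable Cert := Primcodable.ofEquiv _ Cert.equiv

/-- The certificate `t` describes a grid function close to the step function `c`, such that
for all elements of the new ball all but few points have a partial sum larger than `i`. -/
structure Good (c : BallCode) (i : ℕ) (t : Cert) : Prop where
  den : t.N % commonDen c.1 = 0
  pos : 0 < t.N
  lo : (t.v.length : ℚ) ≤ piLo t.w * t.N
  hi : piHi t.w * t.N ≤ t.J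
  near : (∑ j ∈ Finset.range t.J, |stepVal c.1 ((j : ℚ) / (t.N : ℚ)) - listVal t.v j|) / (t.N : ℚ) +
    1 / ((t.s + 1 : ℕ) : ℚ) < ratVal c.2
  half : 2 / ((t.s + 1 : ℕ) : ℚ) < ratVal c.2
  small : i ≤ t.s
  order : 2 * t.L ≤ t.s
  taylor : 2 * ((t.L * t.J : ℕ) : ℚ) / (t.N : ℚ) ≤ ((2 * t.T + 1 : ℕ) : ℚ)
  error : gridNorm t.N t.v t.J * (2 * ((t.L * t.L : ℕ) : ℚ) / (t.N : ℚ) +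
    (t.L : ℚ) * cosErr t.T (((t.L * t.J : ℕ) : ℚ) / (t.N : ℚ))) ≤ 1
  count : (∑ n ∈ Finset.range t.J, if ∀ k < t.L + 1, |riemannSum t.N t.v t.T k n| ≤
    ((4 * i + 2 : ℕ) : ℚ) then 1 else 0) * ((i + 1 : ℕ) : ℚ) ≤ (t.N : ℚ)

/-! ### Primitive recursiveness of the certificate predicate -/

section
variable {α β : Type*} [Primcodable α] [Primcodable β]

@[fun_prop]
theorem PrimrecRat.comp {f : β → ℚ} {g : α → β} (hf : PrimrecRat f) (hg : Primrec g) :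
    PrimrecRat fun a => f (g a) := by
  obtain ⟨f', hf, hf'⟩ := hf
  exact ⟨fun a => f' (g a), hf.comp hg, fun a => hf' (g a)⟩

@[fun_prop]
theorem primrecRat_piLo {k : α → ℕ} (hk : Primrec k) : PrimrecRat fun a => piLo (k a) := by
  unfold piLo; fun_prop

@[fun_prop]
theorem primrecRat_piHi {k : α → ℕ} (hk : Primrec k) : PrimrecRat fun a => piHi (k a) := by
  unfold piHi; fun_prop

@[fun_prop]
theorem primrecRat_stepVal {l : α → ListCode} {x : α → ℚ} (hl : Primrec l) (hx : PrimrecRat x) :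
    PrimrecRat fun a => stepVal (l a) (x a) := by
  unfold stepVal
  fun_prop

@[fun_prop]
theorem primrec_commonDen {l : α → ListCode} (hl : Primrec l) :
    Primrec fun a => commonDen (l a) := by
  unfold commonDen; fun_prop

@[fun_prop]
theorem primrecRat_listVal {v : α → List (ℤ × ℕ)} {j : α → ℕ} (hv : Primrec v) (hj : Primrec j) :
    PrimrecRat fun a => listVal (v a) (j a) := by
  unfold listVal; fun_prop

@[fun_prop]
theorem primrecRat_cosTaylor {T : α → ℕ} {y : α → ℚ} (hT : Primrec T) (hy : PrimrecRat y) :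
    PrimrecRat fun a => cosTaylor (T a) (y a) := by
  unfold cosTaylor
  fun_prop

@[fun_prop]
theorem primrecRat_cosErr {T : α → ℕ} {y : α → ℚ} (hT : Primrec T) (hy : PrimrecRat y) :
    PrimrecRat fun a => cosErr (T a) (y a) := by
  unfold cosErr
  fun_prop

@[fun_prop]
theorem primrecRat_dirichletTaylor {T k : α → ℕ} {y : α → ℚ} (hT : Primrec T) (hk : Primrec k)
    (hy : PrimrecRat y) : PrimrecRat fun a => dirichletTaylor (T a) (k a) (y a) := by
  unfold dirichletTaylor
  fun_prop

@[fun_prop]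
theorem primrecRat_riemannSum {N T k i : α → ℕ} {v : α → List (ℤ × ℕ)} (hN : Primrec N)
    (hv : Primrec v) (hT : Primrec T) (hk : Primrec k) (hi : Primrec i) :
    PrimrecRat fun a => riemannSum (N a) (v a) (T a) (k a) (i a) := by
  unfold riemannSum; fun_prop

@[fun_prop]
theorem primrecRat_gridNorm {N J : α → ℕ} {v : α → List (ℤ × ℕ)} (hN : Primrec N)
    (hv : Primrec v) (hJ : Primrec J) : PrimrecRat fun a => gridNorm (N a) (v a) (J a) := by
  unfold gridNorm; fun_prop

theorem primrec_cert_equiv : Primrec Cert.equiv := Primrec.of_equiv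

@[fun_prop]
theorem primrec_cert_N {t : α → Cert} (ht : Primrec t) : Primrec fun a => (t a).N := by
  have h := primrec_cert_equiv.comp ht
  exact Primrec.fst.comp h

@[fun_prop]
theorem primrec_cert_v {t : α → Cert} (ht : Primrec t) : Primrec fun a => (t a).v := by
  have h := primrec_cert_equiv.comp ht
  exact Primrec.fst.comp (Primrec.snd.comp h)

@[fun_prop]
theorem primrec_cert_s {t : α → Cert} (ht : Primrec t) : Primrec fun a => (t a).s := by
  have h := primrec_cert_equiv.comp ht
  exact Primrec.fst.comp (Primrec.snd.comp (Primrec.snd.comp h))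

@[fun_prop]
theorem primrec_cert_L {t : α → Cert} (ht : Primrec t) : Primrec fun a => (t a).L := by
  have h := primrec_cert_equiv.comp ht
  exact Primrec.fst.comp (Primrec.snd.comp (Primrec.snd.comp (Primrec.snd.comp h)))

@[fun_prop]
theorem primrec_cert_T {t : α → Cert} (ht : Primrec t) : Primrec fun a => (t a).T := by
  have h := primrec_cert_equiv.comp ht
  exact Primrec.fst.comp (Primrec.snd.comp (Primrec.snd.comp (Primrec.snd.comp (Primrec.snd.comp h))))

@[fun_prop]
theorem primrec_cert_w {t : α → Cert} (ht : Primrec t) : Primrec fun a => (t a).w := by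
  have h := primrec_cert_equiv.comp ht
  exact Primrec.fst.comp (Primrec.snd.comp (Primrec.snd.comp (Primrec.snd.comp (Primrec.snd.comp (Primrec.snd.comp h)))))

@[fun_prop]
theorem primrec_cert_J {t : α → Cert} (ht : Primrec t) : Primrec fun a => (t a).J := by
  have h := primrec_cert_equiv.comp ht
  exact Primrec.snd.comp (Primrec.snd.comp (Primrec.snd.comp (Primrec.snd.comp (Primrec.snd.comp (Primrec.snd.comp h)))))

theorem good_iff (c : BallCode) (i : ℕ) (t : Cert) : Good c i t ↔
    t.N % commonDen c.1 = 0 ∧ 0 + 1 ≤ t.N ∧ (t.v.length : ℚ) ≤ piLo t.w * t.N ∧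
    piHi t.w * t.N ≤ t.J ∧
    (∑ j ∈ Finset.range t.J, |stepVal c.1 ((j : ℚ) / (t.N : ℚ)) - listVal t.v j|) / (t.N : ℚ) +
      1 / ((t.s + 1 : ℕ) : ℚ) < ratVal c.2 ∧
    2 / ((t.s + 1 : ℕ) : ℚ) < ratVal c.2 ∧ i ≤ t.s ∧ 2 * t.L ≤ t.s ∧
    2 * ((t.L * t.J : ℕ) : ℚ) / (t.N : ℚ) ≤ ((2 * t.T + 1 : ℕ) : ℚ) ∧
    gridNorm t.N t.v t.J * (2 * ((t.L * t.L : ℕ) : ℚ) / (t.N : ℚ) +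
      (t.L : ℚ) * cosErr t.T (((t.L * t.J : ℕ) : ℚ) / (t.N : ℚ))) ≤ 1 ∧
    (∑ n ∈ Finset.range t.J, if ∀ k < t.L + 1, |riemannSum t.N t.v t.T k n| ≤
      ((4 * i + 2 : ℕ) : ℚ) then 1 else 0) * ((i + 1 : ℕ) : ℚ) ≤ (t.N : ℚ) := by
  constructor
  · rintro ⟨h1, h2, h3, h4, h5, h6, h7, h8, h9, h10, h11⟩
    exact ⟨h1, h2, h3, h4, h5, h6, h7, h8, h9, h10, h11⟩
  · rintro ⟨h1, h2, h3, h4, h5, h6, h7, h8, h9, h10, h11⟩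
    exact ⟨h1, h2, h3, h4, h5, h6, h7, h8, h9, h10, h11⟩

theorem primrecPred_good :
    PrimrecPred fun p : (BallCode × ℕ) × Cert => Good p.1.1 p.1.2 p.2 := by
  simp_rw [good_iff]
  fun_prop

end

/-! ## Unbounded search -/

/-- The value is the first solution in the enumeration of `β`. The last clause records that it
depends only on the set of solutions, which makes normal forms constant on equivalence classes. -/
theorem exists_computable_choice {α β : Type*} [Primcodable α] [Primcodable β]
    {P : α → β → Prop} (hP : ComputablePred fun p : α × β => P p.1 p.2) (h : ∀ a, ∃ b, P a b) :
    ∃ f : α → β, Computable f ∧ (∀ a, P a (f a)) ∧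
      ∀ a a', (∀ b, P a b ↔ P a' b) → f a = f a' := by
  classical
  set g : α → ℕ → Option β := fun a n =>
    (Encodable.decode (α := β) n).bind fun b => bif decide (P a b) then some b else none with hg
  have hgc : Computable₂ g := by
    refine Computable.option_bind (Computable.decode.comp Computable.snd) ?_
    refine Computable.cond ?_ (Computable.option_some.comp Computable.snd)
      (Computable.const none)
    obtain ⟨hd, hP⟩ := hP
    have h1 : Computable fun q : (α × ℕ) × β => (q.1.1, q.2) :=
      (Computable.fst.comp Computable.fst).pair Computable.snd
    exact (hP.comp h1).of_eq fun q => by simp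
  have hmem : ∀ a b n, b ∈ g a n → P a b := by
    intro a b n hb
    obtain ⟨b', -, hb'⟩ := Option.bind_eq_some_iff.1 hb
    by_cases hc : P a b'
    · simp only [hc, decide_true, cond_true, Option.some.injEq] at hb'
      exact hb' ▸ hc
    · simp [hc] at hb'
  have hdom : ∀ a, (Nat.rfindOpt (g a)).Dom := by
    intro a
    obtain ⟨b, hb⟩ := h a
    exact Nat.rfindOpt_dom.2 ⟨Encodable.encode b, b, by simp [hg, hb]⟩
  refine ⟨fun a => (Nat.rfindOpt (g a)).get (hdom a), ?_, fun a => ?_, fun a a' haa => ?_⟩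
  · refine (Partrec.rfindOpt hgc).of_eq fun a => ?_
    exact (Part.some_get (hdom a)).symm
  · obtain ⟨n, hn⟩ := Nat.rfindOpt_spec (Part.get_mem (hdom a))
    exact hmem a _ n hn
  · have : g a = g a' := by
      funext n
      simp only [hg, haa]
    simp only [this]

/-! ## Bounds for `2π` -/

theorem cast_piLo (k : ℕ) : (piLo k : ℝ) = 4 * Real.Wallis.W k := by
  unfold piLo Real.Wallis.W
  push_cast
  rfl

theorem piLo_le (k : ℕ) : (piLo k : ℝ) ≤ 2 * Real.pi := by
  rw [cast_piLo]; linarith [Real.Wallis.W_le k]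

theorem cast_piHi (k : ℕ) : (piHi k : ℝ) = 4 * Real.Wallis.W k * ((2 * k + 2) / (2 * k + 1)) := by
  unfold piHi
  push_cast
  rw [cast_piLo]

theorem le_piHi (k : ℕ) : 2 * Real.pi ≤ piHi k := by
  rw [cast_piHi, ← div_le_iff₀ (by positivity)]
  have h := Real.Wallis.le_W k
  have e : 2 * Real.pi / ((2 * (k : ℝ) + 2) / (2 * k + 1)) =
      4 * ((2 * k + 1) / (2 * k + 2) * (Real.pi / 2)) := by
    field_simp
    ring
  rw [e]; linarith

theorem tendsto_piLo : Tendsto (fun k => (piLo k : ℝ)) atTop (𝓝 (2 * Real.pi)) := by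
  have h := Real.Wallis.tendsto_W_nhds_pi_div_two.const_mul 4
  simp_rw [cast_piLo]
  convert h using 2
  ring

theorem tendsto_piHi : Tendsto (fun k => (piHi k : ℝ)) atTop (𝓝 (2 * Real.pi)) := by
  have h1 : Tendsto (fun k : ℕ => ((2 * k + 2 : ℝ) / (2 * k + 1))) atTop (𝓝 1) := by
    have h2 : Tendsto (fun k : ℕ => 1 + 1 / (2 * (k : ℝ) + 1)) atTop (𝓝 (1 + 0)) := by
      refine tendsto_const_nhds.add (tendsto_const_nhds.div_atTop ?_)
      exact tendsto_atTop_add_const_right _ _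
        (tendsto_natCast_atTop_atTop.const_mul_atTop (by norm_num))
    rw [add_zero] at h2
    refine h2.congr fun k => ?_
    field_simp
    ring
  have h := tendsto_piLo.mul h1
  rw [mul_one] at h
  refine h.congr fun k => ?_
  rw [cast_piLo, cast_piHi]

/-- No grid point equals `2π`, so every comparison of a grid point with `2π` is settled by
sufficiently sharp Wallis bounds. -/
theorem natCast_div_ne_two_pi (j N : ℕ) : (j : ℝ) / N ≠ 2 * Real.pi := by
  intro h
  refine irrational_pi ⟨(j : ℚ) / N / 2, ?_⟩
  push_cast
  rw [h]; ring

/-! ## Step functions on grids -/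

theorem stepFun_eq_sum (l : List (ℚ × ℚ)) (x : ℝ) : stepFun l x =
    ∑ i ∈ Finset.range (l.length - 1), if ((l.getD i (0, 0)).1 : ℝ) ≤ x ∧
      x < ((l.getD (i + 1) (0, 0)).1 : ℝ) then ((l.getD i (0, 0)).2 : ℝ) else 0 := by
  induction l with
  | nil => simp [stepFun]
  | cons p l ih =>
    cases l with
    | nil => simp [stepFun]
    | cons q l =>
      simp only [stepFun]
      rw [ih]
      simp only [List.length_cons, Nat.add_sub_cancel]
      rw [Finset.sum_range_succ' _ l.length, add_comm]
      congr 1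
      simp [Set.indicator_apply]

theorem getD_endpoints (c : BallCode) (i : ℕ) : (BallCode.endpoints c).getD i (0, 0) =
    (ratVal (c.1.getD i ((0, 0), (0, 0))).1, ratVal (c.1.getD i ((0, 0), (0, 0))).2) := by
  have h : ((0 : ℚ), (0 : ℚ)) = (fun p : (ℤ × ℕ) × (ℤ × ℕ) => (ratVal p.1, ratVal p.2))
      ((0, 0), (0, 0)) := by simp [ratVal]
  rw [BallCode.endpoints, h, List.getD_map]

theorem length_endpoints (c : BallCode) : (BallCode.endpoints c).length = c.1.length := by
  simp [BallCode.endpoints]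

theorem commonDen_pos (l : ListCode) : 0 < commonDen l :=
  Finset.prod_pos fun _ _ => Nat.succ_pos _

/-- The break point times `N` is an integer, so replacing `t * N` by its floor does not change the
comparison. -/
theorem ratVal_le_iff {l : ListCode} {N : ℕ} (hN : 0 < N) (hl : commonDen l ∣ N) {i : ℕ}
    (hi : i < l.length) {t : ℝ} (ht : 0 ≤ t) :
    (ratVal (l.getD i ((0, 0), (0, 0))).1 : ℝ) ≤ t ↔
      ratVal (l.getD i ((0, 0), (0, 0))).1 ≤ (⌊t * N⌋₊ : ℚ) / N := by
  set q := (l.getD i ((0, 0), (0, 0))).1 with hq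
  obtain ⟨e, he⟩ : q.2 + 1 ∣ N := (Finset.dvd_prod_of_mem
    (fun i => (l.getD i ((0, 0), (0, 0))).1.2 + 1) (Finset.mem_range.2 hi)).trans hl
  have hNr : (0 : ℝ) < N := by positivity
  have hNq : (0 : ℚ) < N := by positivity
  have hval : ratVal q * N = ((q.1 * e : ℤ) : ℚ) := by
    rw [he, ratVal]
    push_cast
    field_simp
  have hval' : (ratVal q : ℝ) * N = ((q.1 * e : ℤ) : ℝ) := by exact_mod_cast hval
  rw [le_div_iff₀ hNq, hval, ← mul_le_mul_iff_left₀ hNr, hval', ← Int.le_floor,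
    ← Int.natCast_floor_eq_floor (by positivity)]
  exact_mod_cast Iff.rfl

theorem stepFun_endpoints (c : BallCode) {N : ℕ} (hN : 0 < N) (hl : commonDen c.1 ∣ N) {t : ℝ}
    (ht : 0 ≤ t) : stepFun (BallCode.endpoints c) t =
      gridFun N (fun j => stepVal c.1 ((j : ℚ) / (N : ℚ))) t := by
  rw [stepFun_eq_sum, length_endpoints]
  simp only [getD_endpoints, gridFun, stepVal]
  rw [Rat.cast_sum]
  refine Finset.sum_congr rfl fun i hi => ?_
  have hi' := Finset.mem_range.1 hi
  have h1 := ratVal_le_iff hN hl (by omega : i < c.1.length) ht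
  have h2 := ratVal_le_iff hN hl (by omega : i + 1 < c.1.length) ht
  simp only [← not_le, h1, h2]
  split_ifs <;> simp

/-- A cell that starts before `2π` meets `[0,2π]` in positive measure; by irrationality no cell
starts exactly at `2π`. -/
theorem gridFun_ae_eq_iff {N : ℕ} (hN : 0 < N) (u u' : ℕ → ℚ) :
    gridFun N u =ᵐ[mu] gridFun N u' ↔ ∀ j : ℕ, (j : ℝ) / N < 2 * Real.pi → u j = u' j := by
  have hNr : (0 : ℝ) < N := by positivity
  constructor
  · intro h j hj
    by_contra hne
    rw [Filter.EventuallyEq, ae_iff] at h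
    have hpos : 0 < mu (Set.Ico ((j : ℝ) / N) (min ((j + 1 : ℝ) / N) (2 * Real.pi))) := by
      rw [Measure.restrict_apply measurableSet_Ico, Set.inter_eq_left.2, Real.volume_Ico,
        ENNReal.ofReal_pos, sub_pos, lt_min_iff]
      · exact ⟨by gcongr; linarith, hj⟩
      · intro x hx
        exact ⟨le_trans (by positivity) hx.1, (hx.2.trans_le (min_le_right _ _)).le⟩
    refine hpos.ne' (measure_mono_null ?_ h)
    intro x hx
    have h1 := hx.2.trans_le (min_le_left _ _)
    rw [Set.mem_ofPred_eq, gridFun_of_mem hN u hx.1 h1, gridFun_of_mem hN u' hx.1 h1]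
    exact_mod_cast hne
  · intro h
    refine (ae_restrict_iff' measurableSet_Icc).2 (Eventually.of_forall fun t ht => ?_)
    unfold gridFun
    rw [h]
    have h1 : (⌊t * N⌋₊ : ℝ) / N ≤ t := (div_le_iff₀ hNr).2 (Nat.floor_le (by have := ht.1; positivity))
    exact lt_of_le_of_ne (h1.trans ht.2) (natCast_div_ne_two_pi _ _)

/-! ### Deciding whether two codes describe the same ball -/

/-- The element of `L¹` coded by `c`. -/
def codeClass (c : BallCode) : LOne := stepClass (BallCode.endpoints c)

theorem codeClass_coeFn (c : BallCode) {N : ℕ} (hN : 0 < N) (hl : commonDen c.1 ∣ N) :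
    codeClass c =ᵐ[mu] gridFun N (fun j => stepVal c.1 ((j : ℚ) / (N : ℚ))) := by
  refine (MemLp.coeFn_toLp (memLp_stepFun _)).trans ?_
  exact (ae_restrict_iff' measurableSet_Icc).2
    (Eventually.of_forall fun t ht => stepFun_endpoints c hN hl ht.1)

theorem codeClass_eq_iff (c c' : BallCode) : codeClass c = codeClass c' ↔
    ∀ j : ℕ, (j : ℝ) / (commonDen c.1 * commonDen c'.1 : ℕ) < 2 * Real.pi →
      stepVal c.1 ((j : ℚ) / ((commonDen c.1 * commonDen c'.1 : ℕ) : ℚ)) =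
      stepVal c'.1 ((j : ℚ) / ((commonDen c.1 * commonDen c'.1 : ℕ) : ℚ)) := by
  have hN := Nat.mul_pos (commonDen_pos c.1) (commonDen_pos c'.1)
  have h1 := codeClass_coeFn c hN (Dvd.intro _ rfl)
  have h2 := codeClass_coeFn c' hN (Dvd.intro_left _ rfl)
  rw [← gridFun_ae_eq_iff hN (fun j => stepVal c.1 ((j : ℚ) / _))
    (fun j => stepVal c'.1 ((j : ℚ) / _)), Lp.ext_iff]
  exact ⟨fun h => h1.symm.trans (h.trans h2), fun h => h1.trans (h.trans h2.symm)⟩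

/-- Two codes describe the same centre and radius. -/
def Equivalent (c c' : BallCode) : Prop :=
  codeClass c = codeClass c' ∧ ratVal c.2 = ratVal c'.2

/-- Both answers have finite witnesses: agreement on enough cells to cover `[0,2π]`, or one cell
starting before `2π` with different values (or different radii). Searching for either kind of
witness always ends. -/
theorem computablePred_equivalent :
    ComputablePred fun p : BallCode × BallCode => Equivalent p.1 p.2 := by
  set N : BallCode × BallCode → ℕ := fun p => commonDen p.1.1 * commonDen p.2.1 with hNdef
  set P : BallCode × BallCode → (ℕ × ℕ) × Bool → Prop := fun p t =>
    (t.2 = true ∧ ratVal p.1.2 = ratVal p.2.2 ∧ piHi t.1.1 * (N p : ℚ) ≤ (t.1.2 : ℚ) ∧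
      ∀ j < t.1.2, stepVal p.1.1 ((j : ℚ) / (N p : ℚ)) = stepVal p.2.1 ((j : ℚ) / (N p : ℚ))) ∨
    (t.2 = false ∧ (¬ ratVal p.1.2 = ratVal p.2.2 ∨ ((t.1.2 : ℚ) < piLo t.1.1 * (N p : ℚ) ∧
      ¬ stepVal p.1.1 ((t.1.2 : ℚ) / (N p : ℚ)) = stepVal p.2.1 ((t.1.2 : ℚ) / (N p : ℚ)))))
    with hPdef
  have hNp : ∀ p, (0 : ℝ) < N p := fun p => by
    exact_mod_cast Nat.mul_pos (commonDen_pos p.1.1) (commonDen_pos p.2.1)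
  have hPc : PrimrecPred fun q : (BallCode × BallCode) × ((ℕ × ℕ) × Bool) => P q.1 q.2 := by
    simp only [hPdef, hNdef]
    fun_prop
  have hPt : ∀ p t, P p t → (t.2 = true ↔ Equivalent p.1 p.2) := by
    rintro p ⟨⟨w, J⟩, b⟩ (⟨hb, hr, hJ, hall⟩ | ⟨hb, h⟩)
    · simp only at hb hJ hall
      refine ⟨fun _ => ⟨(codeClass_eq_iff _ _).2 fun j hj => hall j ?_, hr⟩, fun _ => hb⟩
      have h1 : (piHi w : ℝ) * N p ≤ J := by exact_mod_cast hJ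
      rw [div_lt_iff₀ (hNp p)] at hj
      have h2 := mul_le_mul_of_nonneg_right (le_piHi w) (hNp p).le
      have h3 : (j : ℝ) < J := by linarith
      exact_mod_cast h3
    · simp only at hb h
      simp only [hb, Bool.false_eq_true, false_iff]
      rintro ⟨hc, hr⟩
      rcases h with h | ⟨hJ, hne⟩
      · exact h hr
      · refine hne ((codeClass_eq_iff _ _).1 hc J ?_)
        have h1 : (J : ℝ) < piLo w * N p := by exact_mod_cast hJ
        exact (div_lt_iff₀ (hNp p)).2
          (h1.trans_le (mul_le_mul_of_nonneg_right (piLo_le w) (hNp p).le))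
  have hex : ∀ p, ∃ t, P p t := by
    intro p
    by_cases hr : ratVal p.1.2 = ratVal p.2.2
    · by_cases hc : codeClass p.1 = codeClass p.2
      -- Strictness comes from irrationality and leaves room for a rational upper bound of `2π`;
      -- every `j` below this ceiling still starts a cell inside `[0,2π]`.
      · have h2 : 2 * Real.pi < (⌈2 * Real.pi * N p⌉₊ : ℝ) / N p := by
          refine lt_of_le_of_ne ((le_div_iff₀ (hNp p)).2 (Nat.le_ceil _))
            (natCast_div_ne_two_pi _ _).symm
        obtain ⟨w, hw⟩ := (tendsto_piHi.eventually (gt_mem_nhds h2)).exists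
        refine ⟨((w, ⌈2 * Real.pi * N p⌉₊), true), Or.inl ⟨rfl, hr, ?_, fun j hj => ?_⟩⟩
        · rw [lt_div_iff₀ (hNp p)] at hw
          exact_mod_cast hw.le
        · refine (codeClass_eq_iff _ _).1 hc j ?_
          exact (div_lt_iff₀ (hNp p)).2 (Nat.lt_ceil.1 hj)
      · have := (codeClass_eq_iff _ _).not.1 hc
        push Not at this
        obtain ⟨j, hj, hne⟩ := this
        obtain ⟨w, hw⟩ := (tendsto_piLo.eventually (lt_mem_nhds hj)).exists
        refine ⟨((w, j), false), Or.inr ⟨rfl, Or.inr ⟨?_, hne⟩⟩⟩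
        have := (div_lt_iff₀ (hNp p)).1 hw
        exact_mod_cast this
    · exact ⟨((0, 0), false), Or.inr ⟨rfl, Or.inl hr⟩⟩
  obtain ⟨f, hf, hfP, -⟩ := exists_computable_choice hPc.computablePred hex
  classical
  refine ⟨inferInstance, ?_⟩
  refine (Computable.snd.comp hf).of_eq fun p => ?_
  have := hPt p (f p) (hfP p)
  rw [Bool.eq_iff_iff, this, decide_eq_true_iff]

/-- A computable choice of representatives. -/
theorem exists_normal_form : ∃ nf : BallCode → BallCode, Computable nf ∧
    (∀ c, Equivalent c (nf c)) ∧ ∀ c c', Equivalent c c' → nf c = nf c' := by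
  obtain ⟨nf, h1, h2, h3⟩ := exists_computable_choice computablePred_equivalent
    fun c => ⟨c, rfl, rfl⟩
  refine ⟨nf, h1, h2, fun c c' h => h3 c c' fun b => ?_⟩
  unfold Equivalent at *
  rw [h.1, h.2]

/-! ## Rational approximation of partial sums -/

theorem mul_I_pow_div_factorial (y : ℚ) (s : ℕ) :
    ((y : ℂ) * Complex.I) ^ (2 * s) / ((2 * s).factorial : ℂ) =
      ((∏ i ∈ Finset.range s, -(y * y) / ((2 * i + 1) * (2 * i + 2) : ℕ) : ℚ) : ℂ) := by
  induction s with
  | zero => simp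
  | succ s ih =>
    rw [Finset.prod_range_succ, Rat.cast_mul, ← ih, show 2 * (s + 1) = 2 * s + 1 + 1 by ring,
      Nat.factorial_succ, Nat.factorial_succ, pow_succ, pow_succ]
    have h1 : ((2 * s).factorial : ℂ) ≠ 0 := by exact_mod_cast (Nat.factorial_pos _).ne'
    have h2 : (2 * (s : ℂ) + 1) ≠ 0 := by exact_mod_cast (Nat.succ_ne_zero (2 * s))
    have h3 : (2 * (s : ℂ) + 1 + 1) ≠ 0 := by exact_mod_cast (Nat.succ_ne_zero (2 * s + 1))
    have h4 : (2 * (s : ℂ) + 2) ≠ 0 := by exact_mod_cast (Nat.succ_ne_zero (2 * s + 1))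
    push_cast
    have e : ∀ z : ℂ, z * (y * Complex.I) * (y * Complex.I) = -(z * (y * y)) := by
      intro z
      linear_combination (z * y * y) * Complex.I_mul_I
    rw [e]
    field_simp
    ring

/-- The odd terms of the exponential series at `iy` are purely imaginary, so the remainder bound for
`exp` transfers to the cosine. -/
theorem re_sum_eq_cosTaylor (y : ℚ) (T : ℕ) :
    (∑ m ∈ Finset.range (2 * T), ((y : ℂ) * Complex.I) ^ m / (m.factorial : ℂ)).re =
      (cosTaylor T y : ℝ) := by
  induction T with
  | zero => simp [cosTaylor]
  | succ T ih =>
    rw [show 2 * (T + 1) = 2 * T + 1 + 1 by ring, Finset.sum_range_succ, Finset.sum_range_succ,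
      Complex.add_re, Complex.add_re, ih]
    have e1 := mul_I_pow_div_factorial y T
    set q : ℚ := ∏ i ∈ Finset.range T, -(y * y) / ((2 * i + 1) * (2 * i + 2) : ℕ) with hq
    have e2 : cosTaylor (T + 1) y = cosTaylor T y + q := by
      unfold cosTaylor; rw [Finset.sum_range_succ]
    have e3 : ((y : ℂ) * Complex.I) ^ (2 * T + 1) / ((2 * T + 1).factorial : ℂ) =
        ((q * y / (2 * T + 1 : ℕ) : ℚ) : ℂ) * Complex.I := by
      push_cast
      rw [← e1, Nat.factorial_succ, pow_succ]
      have h1 : ((2 * T).factorial : ℂ) ≠ 0 := by exact_mod_cast (Nat.factorial_pos _).ne'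
      have h2 : (2 * (T : ℂ) + 1) ≠ 0 := by exact_mod_cast (Nat.succ_ne_zero (2 * T))
      push_cast
      field_simp
    rw [e1, e2, e3, ← Complex.ofReal_ratCast, ← Complex.ofReal_ratCast, Complex.re_ofReal_mul,
      Complex.ofReal_re]
    simp

theorem abs_cos_sub_cosTaylor_le {y Y : ℚ} {T : ℕ} (hy : |y| ≤ Y)
    (hY : 2 * Y ≤ ((2 * T + 1 : ℕ) : ℚ)) :
    |Real.cos y - (cosTaylor T y : ℝ)| ≤ (cosErr T Y : ℝ) := by
  have hnorm : ‖(y : ℂ) * Complex.I‖ = |(y : ℝ)| := by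
    rw [norm_mul, Complex.norm_I, mul_one, ← Complex.ofReal_ratCast, Complex.norm_real,
      Real.norm_eq_abs]
  have hyY : |(y : ℝ)| ≤ Y := by exact_mod_cast hy
  have hY' : 2 * (Y : ℝ) ≤ ((2 * T + 1 : ℕ) : ℝ) := by exact_mod_cast hY
  have h := Complex.exp_bound' (x := (y : ℂ) * Complex.I) (n := 2 * T) (by
    rw [hnorm, div_le_iff₀ (by positivity), Nat.succ_eq_add_one]
    linarith)
  rw [hnorm] at h
  have h1 := (Complex.abs_re_le_norm _).trans h
  rw [Complex.sub_re, re_sum_eq_cosTaylor, ← Complex.ofReal_ratCast,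
    Complex.exp_ofReal_mul_I_re] at h1
  refine h1.trans ?_
  have e : (cosErr T Y : ℝ) = (Y : ℝ) ^ (2 * T) / (2 * T).factorial * 2 := by
    unfold cosErr
    rw [Finset.prod_div_distrib, Finset.prod_const, Finset.card_range,
      ← Finset.prod_range_add_one_eq_factorial]
    push_cast
    ring
  rw [e]
  gcongr

theorem cosErr_nonneg {Y : ℚ} (hY : 0 ≤ Y) (T : ℕ) : 0 ≤ cosErr T Y := by
  unfold cosErr; positivity

theorem abs_dirichlet_sub_dirichletTaylor_le {y Y : ℚ} {T k : ℕ} (hy : k * |y| ≤ Y)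
    (hY : 2 * Y ≤ ((2 * T + 1 : ℕ) : ℚ)) :
    |dirichlet k y - (dirichletTaylor T k y : ℝ)| ≤ k * (cosErr T Y : ℝ) := by
  have e : dirichlet k y - (dirichletTaylor T k y : ℝ) = ∑ m ∈ Finset.range k,
      (Real.cos (((m + 1 : ℕ) : ℚ) * y : ℚ) - (cosTaylor T (((m + 1 : ℕ) : ℚ) * y) : ℝ)) := by
    unfold dirichlet dirichletTaylor
    rw [Finset.sum_sub_distrib, ← Finset.Ico_add_one_right_eq_Icc, Finset.sum_Ico_eq_sum_range]
    push_cast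
    simp [add_comm]
  rw [e]
  refine (Finset.abs_sum_le_sum_abs _ _).trans ?_
  refine (Finset.sum_le_sum fun m hm => abs_cos_sub_cosTaylor_le (Y := Y) ?_ hY).trans ?_
  · refine le_trans ?_ hy
    rw [abs_mul, Nat.abs_cast]
    have : ((m + 1 : ℕ) : ℚ) ≤ k := by exact_mod_cast Finset.mem_range.1 hm
    gcongr
  · simp

theorem listVal_eq_zero {v : List (ℤ × ℕ)} {j : ℕ} (hj : v.length ≤ j) : listVal v j = 0 := by
  rw [listVal, List.getD_eq_default _ _ hj]
  simp [ratVal]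

/-- Two errors occur per unit of mass: moving `x - t` to the grid difference `(n - j)/N` costs at
most `L²/N`, and the Taylor polynomials cost `L * cosErr`. The factor `2` in the hypothesis is
slack. -/
theorem abs_dirInt_sub_riemannSum_le {N L T J : ℕ} {v : List (ℤ × ℕ)} (hN : 0 < N)
    (hlen : (v.length : ℝ) / N ≤ 2 * Real.pi) (hJ : v.length ≤ J)
    (htaylor : 2 * ((L * J : ℕ) : ℚ) / (N : ℚ) ≤ ((2 * T + 1 : ℕ) : ℚ))
    (herr : gridNorm N v J * (2 * ((L * L : ℕ) : ℚ) / (N : ℚ) +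
      (L : ℚ) * cosErr T (((L * J : ℕ) : ℚ) / (N : ℚ))) ≤ 1)
    {k n : ℕ} (hk : k ≤ L) (hn : n < J) {x : ℝ} (hx0 : (n : ℝ) / N ≤ x)
    (hx1 : x ≤ (n + 1 : ℝ) / N) :
    |dirInt (gridFun N (listVal v)) k x - (riemannSum N v T k n : ℝ)| ≤ 1 := by
  have hNr : (0 : ℝ) < N := by positivity
  have hNq : (0 : ℚ) < N := by positivity
  set Y : ℚ := ((L * J : ℕ) : ℚ) / (N : ℚ) with hY
  have hY0 : 0 ≤ Y := by positivity
  have he0 : (0 : ℝ) ≤ cosErr T Y := by exact_mod_cast cosErr_nonneg hY0 T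
  set E : ℝ := 2 * ((L * L : ℕ) : ℝ) / N + L * cosErr T Y with hE
  have hcont : Continuous fun t => dirichlet k (x - t) :=
    (continuous_dirichlet k).comp (by fun_prop)
  have e1 : dirInt (gridFun N (listVal v)) k x - (riemannSum N v T k n : ℝ) =
      ∑ j ∈ Finset.range v.length, (listVal v j : ℝ) *
        ∫ t in ((j : ℝ) / N)..((j + 1 : ℝ) / N), (dirichlet k (x - t) -
          (dirichletTaylor T k (((n : ℚ) - (j : ℚ)) / (N : ℚ)) : ℝ)) := by
    unfold dirInt riemannSum
    rw [integral_gridFun_mul_of_le hN hcont (fun j => listVal_eq_zero) hlen, Rat.cast_div,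
      Rat.cast_sum, Finset.sum_div, ← Finset.sum_sub_distrib]
    refine Finset.sum_congr rfl fun j _ => ?_
    rw [intervalIntegral.integral_sub (hcont.intervalIntegrable _ _) (by simp),
      intervalIntegral.integral_const, smul_eq_mul, show ((j : ℝ) + 1) / N - j / N = 1 / N by ring]
    push_cast
    ring
  have hcell : ∀ j ∈ Finset.range v.length,
      |(listVal v j : ℝ) * ∫ t in ((j : ℝ) / N)..((j + 1 : ℝ) / N), (dirichlet k (x - t) -
          (dirichletTaylor T k (((n : ℚ) - (j : ℚ)) / (N : ℚ)) : ℝ))| ≤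
      |(listVal v j : ℝ)| / N * E := by
    intro j hj
    have hjJ : j < J := (Finset.mem_range.1 hj).trans_le hJ
    rw [abs_mul, div_mul_eq_mul_div, mul_div_assoc]
    refine mul_le_mul_of_nonneg_left ?_ (abs_nonneg _)
    have hle : (j : ℝ) / N ≤ (j + 1 : ℝ) / N := by gcongr; linarith
    have h := intervalIntegral.norm_integral_le_of_norm_le_const (C := E) (a := (j : ℝ) / N)
      (b := (j + 1 : ℝ) / N) (f := fun t => dirichlet k (x - t) -
          (dirichletTaylor T k (((n : ℚ) - (j : ℚ)) / (N : ℚ)) : ℝ)) fun t ht => by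
        rw [Set.uIoc_of_le hle] at ht
        set y : ℚ := ((n : ℚ) - (j : ℚ)) / (N : ℚ) with hy
        have hyr : (y : ℝ) = ((n : ℝ) - j) / N := by rw [hy]; push_cast; rfl
        have hkL : (k : ℝ) ≤ L := by exact_mod_cast hk
        have h1 : |dirichlet k (x - t) - dirichlet k y| ≤ ((L * L : ℕ) : ℝ) / N := by
          refine (abs_dirichlet_sub_le k _ _).trans ?_
          have h2 : |x - t - y| ≤ 1 / N := by
            rw [hyr]
            have a1 : ((n : ℝ) + 1) / N = n / N + 1 / N := by ring
            have a2 : ((j : ℝ) + 1) / N = j / N + 1 / N := by ring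
            have a3 : ((n : ℝ) - j) / N = n / N - j / N := by ring
            rw [a3]
            exact abs_le.2 ⟨by linarith [ht.2], by linarith [ht.1]⟩
          calc (k : ℝ) ^ 2 * |x - t - y| ≤ (L : ℝ) ^ 2 * (1 / N) := by gcongr
            _ = ((L * L : ℕ) : ℝ) / N := by push_cast; ring
        have h3 : |dirichlet k y - (dirichletTaylor T k y : ℝ)| ≤ k * (cosErr T Y : ℝ) := by
          refine abs_dirichlet_sub_dirichletTaylor_le ?_ (by rw [hY, ← mul_div_assoc]; exact htaylor)
          rw [hy, hY, abs_div, Nat.abs_cast, ← mul_div_assoc]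
          have a1 : |(n : ℚ) - j| ≤ J := by
            have b1 : (n : ℚ) ≤ J := by exact_mod_cast hn.le
            have b2 : (j : ℚ) ≤ J := by exact_mod_cast hjJ.le
            exact abs_le.2 ⟨by linarith [(Nat.cast_nonneg n : (0 : ℚ) ≤ n)],
              by linarith [(Nat.cast_nonneg j : (0 : ℚ) ≤ j)]⟩
          have a2 : (k : ℚ) ≤ L := by exact_mod_cast hk
          push_cast
          gcongr
        have h4 : (k : ℝ) * cosErr T Y ≤ L * cosErr T Y := by gcongr
        have h5 : ((L * L : ℕ) : ℝ) / N ≤ 2 * ((L * L : ℕ) : ℝ) / N := by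
          gcongr
          linarith [(Nat.cast_nonneg (L * L) : (0 : ℝ) ≤ (L * L : ℕ))]
        have h6 := abs_add_le (dirichlet k (x - t) - dirichlet k y)
          (dirichlet k y - (dirichletTaylor T k y : ℝ))
        rw [sub_add_sub_cancel] at h6
        rw [Real.norm_eq_abs]
        linarith
    rw [show ((j : ℝ) + 1) / N - j / N = 1 / N by ring,
      abs_of_pos (by positivity : (0 : ℝ) < 1 / N)] at h
    rw [Real.norm_eq_abs] at h
    rw [div_eq_mul_one_div E]
    exact h
  have hsum : ∑ j ∈ Finset.range v.length, |(listVal v j : ℝ)| / N ≤ (gridNorm N v J : ℝ) := by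
    unfold gridNorm
    push_cast
    rw [← Finset.sum_div]
    gcongr
  have herr' : (gridNorm N v J : ℝ) * E ≤ 1 := by
    rw [hE]
    have h := (Rat.cast_le (K := ℝ)).2 herr
    push_cast at h ⊢
    exact h
  rw [e1]
  refine (Finset.abs_sum_le_sum_abs _ _).trans ((Finset.sum_le_sum hcell).trans ?_)
  rw [← Finset.sum_mul]
  exact (mul_le_mul_of_nonneg_right hsum (by positivity)).trans herr'

/-! ## The ball of a certificate -/

/-- The code of the ball given by a certificate. -/
def Cert.out (t : Cert) : BallCode :=
  ((List.range (t.v.length + 1)).map fun j : ℕ => (((j : ℤ), t.N - 1), t.v.getD j (0, 0)), ((1 : ℤ), t.s))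

theorem primrec_out : Primrec Cert.out := by
  have h1 : Primrec fun p : Cert × ℕ => (((p.2 : ℤ), p.1.N - 1), p.1.v.getD p.2 (0, 0)) := by
    have := primrec_natCast_int.comp (Primrec.snd (α := Cert) (β := ℕ))
    fun_prop
  refine Primrec.pair (Primrec.list_map (Primrec.list_range.comp ?_) h1) (Primrec.pair ?_ ?_) <;>
    fun_prop

theorem ratVal_out (t : Cert) : ratVal t.out.2 = 1 / ((t.s + 1 : ℕ) : ℚ) := by
  simp [ratVal, Cert.out]

theorem endpoints_out {t : Cert} (hN : 0 < t.N) : BallCode.endpoints t.out =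
    (List.range (t.v.length + 1)).map fun j : ℕ => ((j : ℚ) / (t.N : ℚ), listVal t.v j) := by
  have : ((t.N - 1 : ℕ) : ℚ) + 1 = t.N := by rw [Nat.cast_sub hN]; simp
  simp [BallCode.endpoints, Cert.out, ratVal, listVal, this]

theorem isEndpointList_out {t : Cert} (hN : 0 < t.N) :
    IsEndpointList (BallCode.endpoints t.out) := by
  have hNq : (0 : ℚ) < t.N := by positivity
  rw [endpoints_out hN, IsEndpointList, List.pairwise_map]
  refine List.pairwise_lt_range.imp fun {a b} h => ?_
  have : (a : ℚ) < b := by exact_mod_cast h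
  simp only
  gcongr

theorem stepFun_out {t : Cert} (hN : 0 < t.N) {x : ℝ} (hx : 0 ≤ x) :
    stepFun (BallCode.endpoints t.out) x = gridFun t.N (listVal t.v) x := by
  have hNr : (0 : ℝ) < t.N := by positivity
  rw [endpoints_out hN, stepFun_eq_sum, List.length_map, List.length_range, Nat.add_sub_cancel]
  have h : ∀ i ∈ Finset.range t.v.length, (if ((((List.range (t.v.length + 1)).map fun j : ℕ =>
      ((j : ℚ) / (t.N : ℚ), listVal t.v j)).getD i (0, 0)).1 : ℝ) ≤ x ∧
      x < ((((List.range (t.v.length + 1)).map fun j : ℕ =>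
      ((j : ℚ) / (t.N : ℚ), listVal t.v j)).getD (i + 1) (0, 0)).1 : ℝ) then
      ((((List.range (t.v.length + 1)).map fun j : ℕ =>
      ((j : ℚ) / (t.N : ℚ), listVal t.v j)).getD i (0, 0)).2 : ℝ) else 0) =
      if i = ⌊x * t.N⌋₊ then (listVal t.v i : ℝ) else 0 := by
    intro i hi
    have hi' := Finset.mem_range.1 hi
    have g1 : ((List.range (t.v.length + 1)).map fun j : ℕ =>
      ((j : ℚ) / (t.N : ℚ), listVal t.v j)).getD i (0, 0) = ((i : ℚ) / t.N, listVal t.v i) := by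
      simp [List.getD_eq_getElem?_getD, List.getElem?_range (by omega : i < t.v.length + 1)]
    have g2 : ((List.range (t.v.length + 1)).map fun j : ℕ =>
      ((j : ℚ) / (t.N : ℚ), listVal t.v j)).getD (i + 1) (0, 0) =
        (((i + 1 : ℕ) : ℚ) / t.N, listVal t.v (i + 1)) := by
      simp [List.getD_eq_getElem?_getD, List.getElem?_range (by omega : i + 1 < t.v.length + 1)]
    rw [g1, g2]
    refine if_congr ?_ rfl rfl
    rw [eq_comm, Nat.floor_eq_iff (by positivity)]
    push_cast
    rw [div_le_iff₀ hNr, lt_div_iff₀ hNr]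
  rw [Finset.sum_congr rfl h, Finset.sum_ite_eq']
  split_ifs with hm
  · rfl
  · unfold gridFun
    rw [listVal_eq_zero (by simpa using hm), Rat.cast_zero]

theorem codeClass_out_coeFn {t : Cert} (hN : 0 < t.N) :
    codeClass t.out =ᵐ[mu] gridFun t.N (listVal t.v) :=
  (MemLp.coeFn_toLp (memLp_stepFun _)).trans ((ae_restrict_iff' measurableSet_Icc).2
    (Eventually.of_forall fun _ hx => stepFun_out hN hx.1))

theorem nrm_eq_integral (g : ℝ → ℝ) : nrm g = ∫ x, |g x| ∂mu := by
  unfold nrm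
  rw [intervalIntegral.integral_of_le Real.two_pi_pos.le, integral_Icc_eq_integral_Ioc]

theorem nrm_congr {f g : ℝ → ℝ} (h : f =ᵐ[mu] g) : nrm f = nrm g := by
  rw [nrm_eq_integral, nrm_eq_integral]
  refine integral_congr_ae ?_
  filter_upwards [h] with x hx
  rw [hx]

theorem dist_eq_nrm (f g : LOne) : dist f g = nrm (fun x => f x - g x) := by
  rw [nrm_eq_integral]
  have h := L1.dist_eq_integral_dist f g
  simp_rw [Real.dist_eq] at h
  exact h

theorem nrm_gridFun_le {N J : ℕ} (hN : 0 < N) (u : ℕ → ℚ) (hJ : 2 * Real.pi ≤ J / N) :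
    nrm (gridFun N u) ≤ ((∑ j ∈ Finset.range J, |u j|) / (N : ℚ) : ℚ) := by
  have h := integral_abs_gridFun hN u J
  have h1 : nrm (gridFun N u) ≤ ∫ t in (0 : ℝ)..(J / N), |gridFun N u t| :=
    intervalIntegral.integral_mono_interval le_rfl Real.two_pi_pos.le hJ
      (Eventually.of_forall fun _ => abs_nonneg _) (intervalIntegrable_gridFun N u _ _).abs
  rw [h] at h1
  refine h1.trans (le_of_eq ?_)
  push_cast
  ring

theorem dist_codeClass_out_le {c : BallCode} {t : Cert} (hN : 0 < t.N)
    (hden : commonDen c.1 ∣ t.N) {J : ℕ} (hJ : 2 * Real.pi ≤ J / t.N) :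
    dist (codeClass t.out) (codeClass c) ≤ ((∑ j ∈ Finset.range J,
      |stepVal c.1 ((j : ℚ) / (t.N : ℚ)) - listVal t.v j|) / (t.N : ℚ) : ℚ) := by
  rw [dist_comm, dist_eq_nrm]
  refine le_trans (le_of_eq (nrm_congr ?_)) (nrm_gridFun_le hN _ hJ)
  filter_upwards [codeClass_coeFn c hN hden, codeClass_out_coeFn hN] with x h1 h2
  rw [h1, h2]
  simp [gridFun]

theorem mu_iUnion_cells_le {N : ℕ} (S : Finset ℕ) :
    volume (⋃ n ∈ S, Set.Ico ((n : ℝ) / N) ((n + 1 : ℝ) / N)) ≤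
      ENNReal.ofReal ((S.card : ℝ) / N) := by
  refine (measure_biUnion_finset_le _ _).trans ?_
  have h : ∀ n ∈ S, volume (Set.Ico ((n : ℝ) / N) ((n + 1 : ℝ) / N)) = ENNReal.ofReal (1 / N) := by
    intro n _
    rw [Real.volume_Ico]
    congr 1; ring
  rw [Finset.sum_congr rfl h, Finset.sum_const, nsmul_eq_mul, ← ENNReal.ofReal_natCast,
    ← ENNReal.ofReal_mul (by positivity)]
  refine ENNReal.ofReal_le_ofReal (le_of_eq ?_)
  ring

theorem Good.length_div_le {c : BallCode} {i : ℕ} {t : Cert} (h : Good c i t) :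
    (t.v.length : ℝ) / t.N ≤ 2 * Real.pi := by
  have hNr : (0 : ℝ) < t.N := by exact_mod_cast h.pos
  have h1 : (t.v.length : ℝ) ≤ piLo t.w * t.N := by exact_mod_cast h.lo
  exact (div_le_iff₀ hNr).2 (h1.trans (mul_le_mul_of_nonneg_right (piLo_le _) hNr.le))

theorem Good.le_J_div {c : BallCode} {i : ℕ} {t : Cert} (h : Good c i t) :
    2 * Real.pi ≤ (t.J : ℝ) / t.N := by
  have hNr : (0 : ℝ) < t.N := by exact_mod_cast h.pos
  have h1 : (piHi t.w : ℝ) * t.N ≤ t.J := by exact_mod_cast h.hi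
  exact (le_div_iff₀ hNr).2 ((mul_le_mul_of_nonneg_right (le_piHi _) hNr.le).trans h1)

theorem Good.dist_lt {c : BallCode} {i : ℕ} {t : Cert} (h : Good c i t) :
    dist (codeClass t.out) (codeClass c) + (ratVal t.out.2 : ℝ) < ratVal c.2 := by
  have h1 := dist_codeClass_out_le (c := c) h.pos (Nat.dvd_of_mod_eq_zero h.den) h.le_J_div
  have h2 := (Rat.cast_lt (K := ℝ)).2 h.near
  rw [Rat.cast_add] at h2
  rw [ratVal_out]
  linarith

/-- A point where all partial sums of `f` are at most `i` has `|dirInt f k x| ≤ π i ≤ 4i`. Passing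
to the centre costs `1` and to the Riemann sum another `1`, so the point lies in one of the cells
counted with threshold `4i + 2`. -/
theorem Good.measure_le {c : BallCode} {i : ℕ} {t : Cert} (h : Good c i t) {f : LOne}
    (hf : dist f (codeClass t.out) < ratVal t.out.2) :
    mu {x | ∀ k, |fourierPartialSum f k x| ≤ i} ≤ ENNReal.ofReal (1 / (i + 1)) := by
  have hpi := Real.pi_pos
  have hNr : (0 : ℝ) < t.N := by exact_mod_cast h.pos
  set g := gridFun t.N (listVal t.v) with hg
  have hgi : IntOn g := intervalIntegrable_gridFun _ _ _ _
  have hnrm : nrm (fun x => f x - g x) < 1 / (t.s + 1) := by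
    rw [dist_eq_nrm, ratVal_out, nrm_congr (g := fun x => f x - g x)] at hf
    · push_cast at hf
      exact hf
    · filter_upwards [codeClass_out_coeFn h.pos] with x hx
      rw [hx]
  set S := (Finset.range t.J).filter fun n => ∀ k < t.L + 1, |riemannSum t.N t.v t.T k n| ≤
    ((4 * i + 2 : ℕ) : ℚ) with hS
  have hcard : (S.card : ℝ) / t.N ≤ 1 / (i + 1) := by
    have h1 := h.count
    rw [Finset.sum_boole] at h1
    rw [div_le_div_iff₀ hNr (by positivity)]
    have h2 : (S.card : ℚ) * ((i + 1 : ℕ) : ℚ) ≤ (t.N : ℚ) := h1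
    have h3 : (S.card : ℝ) * ((i + 1 : ℕ) : ℝ) ≤ (t.N : ℝ) := by exact_mod_cast h2
    push_cast at h3
    linarith
  have hlenJ : t.v.length ≤ t.J := by
    have h1 : (t.v.length : ℝ) / t.N ≤ t.J / t.N := h.length_div_le.trans h.le_J_div
    rw [div_le_div_iff_of_pos_right hNr] at h1
    exact_mod_cast h1
  have hsub : {x | ∀ k, |fourierPartialSum f k x| ≤ i} ∩ Set.Icc 0 (2 * Real.pi) ⊆
      ⋃ n ∈ S, Set.Ico ((n : ℝ) / t.N) ((n + 1 : ℝ) / t.N) := by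
    rintro x ⟨hx, hx0, hx1⟩
    have hx2 : x < (t.J : ℝ) / t.N :=
      lt_of_le_of_ne (hx1.trans h.le_J_div) fun he =>
        natCast_div_ne_two_pi t.J t.N (le_antisymm (he ▸ hx1) h.le_J_div)
    have hn0 : (⌊x * t.N⌋₊ : ℝ) ≤ x * t.N := Nat.floor_le (by positivity)
    have hn1 := Nat.lt_floor_add_one (x * t.N)
    have hnJ : ⌊x * t.N⌋₊ < t.J := (Nat.floor_lt (by positivity)).2 ((lt_div_iff₀ hNr).1 hx2)
    have hm0 : (⌊x * t.N⌋₊ : ℝ) / t.N ≤ x := (div_le_iff₀ hNr).2 hn0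
    have hm1 : x < (⌊x * t.N⌋₊ + 1 : ℝ) / t.N := (lt_div_iff₀ hNr).2 hn1
    refine Set.mem_biUnion (x := ⌊x * t.N⌋₊) ?_ ⟨hm0, hm1⟩
    rw [hS, Finset.mem_coe, Finset.mem_filter, Finset.mem_range]
    refine ⟨hnJ, fun k hk => ?_⟩
    have h1 := abs_dirInt_sub_riemannSum_le h.pos h.length_div_le hlenJ h.taylor h.error
      (Nat.lt_succ_iff.1 hk) hnJ hm0 hm1.le
    rw [← hg] at h1
    have h2 : |dirInt f k x| ≤ 4 * i := by
      rw [← pi_mul_fourierPartialSum, abs_mul, abs_of_pos hpi]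
      have := hx k
      have := Real.pi_le_four
      gcongr
    -- The condition `2L ≤ s` enters here: `(k + 1/2)/(s + 1) ≤ 1` for all `k ≤ L`.
    have h3 : |dirInt f k x - dirInt g k x| ≤ 1 := by
      rw [← dirInt_sub (intOn_coe f) hgi]
      refine (abs_dirInt_le ((intOn_coe f).sub hgi) k x).trans ?_
      have hs : (2 : ℝ) * t.L ≤ t.s := by exact_mod_cast h.order
      have hk' : (k : ℝ) ≤ t.L := by exact_mod_cast Nat.lt_succ_iff.1 hk
      have hb : (0 : ℝ) < (t.s : ℝ) + 1 := by positivity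
      calc ((k : ℝ) + 1 / 2) * nrm (fun x => f x - g x)
          ≤ ((t.s : ℝ) + 1) * (1 / (t.s + 1)) := by
            refine mul_le_mul (by linarith) hnrm.le (nrm_nonneg _) hb.le
        _ = 1 := by field_simp
    have h4 : |(riemannSum t.N t.v t.T k ⌊x * t.N⌋₊ : ℝ)| ≤ ((4 * i + 2 : ℕ) : ℝ) := by
      rw [abs_le] at *
      push_cast
      constructor <;> linarith [h1.1, h1.2, h2.1, h2.2, h3.1, h3.2]
    exact_mod_cast h4
  rw [Measure.restrict_apply' measurableSet_Icc]
  exact (measure_mono hsub).trans ((mu_iUnion_cells_le S).trans (ENNReal.ofReal_le_ofReal hcard))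

/-! ## Existence of certificates -/

theorem card_div_le_volume {N : ℕ} (hN : 0 < N) (S : Finset ℕ) {E : Set ℝ}
    (h : ∀ n ∈ S, Set.Ico ((n : ℝ) / N) ((n + 1 : ℝ) / N) ⊆ E) :
    ENNReal.ofReal ((S.card : ℝ) / N) ≤ volume E := by
  have hNr : (0 : ℝ) < N := by positivity
  have hfloor : ∀ n : ℕ, ∀ x ∈ Set.Ico ((n : ℝ) / N) ((n + 1 : ℝ) / N), ⌊x * N⌋₊ = n := by
    intro n x hx
    have h0 := (div_le_iff₀ hNr).1 hx.1
    exact (Nat.floor_eq_iff ((Nat.cast_nonneg n).trans h0)).2 ⟨h0, (lt_div_iff₀ hNr).1 hx.2⟩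
  have hd : Set.PairwiseDisjoint (S : Set ℕ)
      fun n : ℕ => Set.Ico ((n : ℝ) / N) ((n + 1 : ℝ) / N) := by
    intro a _ b _ hab
    refine Set.disjoint_left.2 fun x ha hb => hab ?_
    rw [← hfloor a x ha, hfloor b x hb]
  have hv : ∀ n ∈ S, volume (Set.Ico ((n : ℝ) / N) ((n + 1 : ℝ) / N)) = ENNReal.ofReal (1 / N) := by
    intro n _
    rw [Real.volume_Ico]
    congr 1; ring
  calc ENNReal.ofReal ((S.card : ℝ) / N)
      = volume (⋃ n ∈ S, Set.Ico ((n : ℝ) / N) ((n + 1 : ℝ) / N)) := by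
        rw [measure_biUnion_finset hd fun _ _ => measurableSet_Ico, Finset.sum_congr rfl hv,
          Finset.sum_const, nsmul_eq_mul, ← ENNReal.ofReal_natCast,
          ← ENNReal.ofReal_mul (by positivity)]
        congr 1; ring
    _ ≤ volume E := measure_mono (Set.iUnion₂_subset h)

theorem exists_list_code (u : ℕ → ℚ) {len : ℕ} (hu : ∀ j, len ≤ j → u j = 0) :
    ∃ v : List (ℤ × ℕ), v.length = len ∧ listVal v = u := by
  refine ⟨(List.range len).map fun j => ((u j).num, (u j).den - 1), by simp, ?_⟩
  ext1 j
  rcases lt_or_ge j len with h | h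
  · have h2 : (((u j).den - 1 : ℕ) : ℚ) + 1 = (u j).den := by
      rw [Nat.cast_sub (u j).den_pos]; simp
    simp [listVal, List.getD_eq_getElem?_getD, List.getElem?_range h, ratVal, h2,
      Rat.num_div_den]
  · rw [listVal_eq_zero (by simpa using h), hu j h]

theorem exists_stepVal_bound (l : ListCode) : ∃ C : ℝ, 0 < C ∧ ∀ x, |(stepVal l x : ℝ)| ≤ C := by
  refine ⟨((∑ i ∈ Finset.range (l.length - 1), |ratVal (l.getD i ((0, 0), (0, 0))).2| : ℚ) : ℝ) + 1,
    by positivity, fun x => ?_⟩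
  have h : |stepVal l x| ≤
      ∑ i ∈ Finset.range (l.length - 1), |ratVal (l.getD i ((0, 0), (0, 0))).2| := by
    unfold stepVal
    refine (Finset.abs_sum_le_sum_abs _ _).trans (Finset.sum_le_sum fun i _ => ?_)
    split_ifs
    · exact le_rfl
    · rw [abs_zero]; exact abs_nonneg _
  have h' := (Rat.cast_le (K := ℝ)).2 h
  rw [Rat.cast_abs] at h'
  linarith

theorem nrm_sub_le {f g h : ℝ → ℝ} (hf : IntOn f) (hg : IntOn g) (hh : IntOn h) :
    nrm (fun t => f t - h t) ≤ nrm (fun t => f t - g t) + nrm (fun t => g t - h t) := by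
  unfold nrm
  rw [← intervalIntegral.integral_add (hf.sub hg).abs (hg.sub hh).abs]
  exact intervalIntegral.integral_mono Real.two_pi_pos.le (hf.sub hh).abs
    ((hf.sub hg).abs.add (hg.sub hh).abs) fun t => abs_sub_le _ _ _

/-- Near every step function there is a grid function with large partial sums. -/
theorem exists_isGrid_near (c : BallCode) {ρ : ℝ} (hρ : 0 < ρ) (M : ℝ) {η : ℝ} (hη : 0 < η) :
    ∃ f, IsGrid f ∧ nrm (fun t => codeClass c t - f t) < ρ ∧ ∃ L : ℕ,
      volume {x | x ∈ Set.Icc 0 (2 * Real.pi) ∧ ∀ k ≤ L, |dirInt f k x| ≤ M} <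
        ENNReal.ofReal η := by
  have hpi := Real.pi_pos
  obtain ⟨C, hC0, hC⟩ := exists_stepVal_bound c.1
  -- The grid is so fine that deleting one cell, of norm at most `C/N`, costs less than `ρ/2`.
  obtain ⟨k, hk⟩ := exists_nat_gt (C / (ρ / 2))
  have hk0 : 0 < k := by
    have : (0 : ℝ) < k := lt_of_le_of_lt (by positivity) hk
    exact_mod_cast this
  set N := commonDen c.1 * k with hN
  have hN0 : 0 < N := Nat.mul_pos (commonDen_pos _) hk0
  have hNr : (0 : ℝ) < N := by exact_mod_cast hN0
  have hkN : (k : ℝ) ≤ N := by exact_mod_cast Nat.le_mul_of_pos_left k (commonDen_pos c.1)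
  obtain ⟨m, hm⟩ : ∃ m, ⌈2 * Real.pi * N⌉₊ = m + 1 :=
    ⟨_, (Nat.succ_pred_eq_of_pos (Nat.ceil_pos.2 (by positivity))).symm⟩
  have hm0 : (m : ℝ) < 2 * Real.pi * N := Nat.lt_ceil.1 (by omega)
  have hm1 : 2 * Real.pi * N ≤ ((m + 1 : ℕ) : ℝ) := hm ▸ Nat.le_ceil _
  set u : ℕ → ℚ := fun j => stepVal c.1 ((j : ℚ) / (N : ℚ)) with hu
  -- Cell `m` is the one that contains `2π`; it is dropped so that the function vanishes from a
  -- point below `2π` on, as `IsGrid` demands.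
  set u' : ℕ → ℚ := fun j => if j < m then u j else 0 with hu'
  have hψ : IsGrid (gridFun N u') :=
    ⟨N, hN0, u', m, (div_lt_iff₀ hNr).2 hm0, fun j hj => if_neg (by omega), rfl⟩
  obtain ⟨f, hf, hfn, L, hL⟩ := kolmogorov hψ (half_pos hρ) M hη
  refine ⟨f, hf, ?_, L, hL⟩
  have h1 := nrm_sub_le (intOn_coe (codeClass c)) hψ.intOn hf.intOn
  have h2 : nrm (fun t => gridFun N u' t - f t) = nrm (fun t => f t - gridFun N u' t) := by
    unfold nrm; simp_rw [abs_sub_comm]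
  have h3 : nrm (fun t => codeClass c t - gridFun N u' t) < ρ / 2 := by
    have e : nrm (fun t => codeClass c t - gridFun N u' t) = nrm (gridFun N fun j => u j - u' j) := by
      refine nrm_congr ?_
      filter_upwards [codeClass_coeFn c hN0 (Dvd.intro _ rfl)] with t ht
      rw [ht]
      simp [gridFun, hu]
    rw [e]
    refine (nrm_gridFun_le hN0 _ ((le_div_iff₀ hNr).2 hm1)).trans_lt ?_
    have hs : ∑ j ∈ Finset.range (m + 1), |u j - u' j| = |u m| := by
      rw [Finset.sum_range_succ, Finset.sum_eq_zero, zero_add]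
      · simp [hu']
      · intro j hj
        simp [hu', Finset.mem_range.1 hj]
    rw [hs]
    push_cast
    rw [div_lt_iff₀ (by positivity)] at hk
    rw [div_lt_iff₀ hNr]
    have := hC ((m : ℚ) / (N : ℚ))
    have h4 : |((u m : ℚ) : ℝ)| ≤ C := this
    nlinarith
  rw [h2] at h1
  linarith

/-- A counted cell inside `[0,2π]` lies wholly in the exceptional set for the threshold `4i + 3`, so
volume bounds the number of these cells. The remaining cells, from the one containing `2π` up to
`J`, are all counted as bad. -/
theorem card_bad_le {N L J i T : ℕ} {v : List (ℤ × ℕ)} (hN : 0 < N) {η : ℝ} (hη : 0 < η)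
    (happ : ∀ k ≤ L, ∀ n < J, ∀ x : ℝ, (n : ℝ) / N ≤ x → x ≤ (n + 1 : ℝ) / N →
      |dirInt (gridFun N (listVal v)) k x - (riemannSum N v T k n : ℝ)| ≤ 1)
    (hvol : volume {x | x ∈ Set.Icc 0 (2 * Real.pi) ∧
      ∀ k ≤ L, |dirInt (gridFun N (listVal v)) k x| ≤ 4 * i + 3} < ENNReal.ofReal η)
    (hJ : 2 * Real.pi * N ≤ J) :
    (((Finset.range J).filter fun n => ∀ k < L + 1, |riemannSum N v T k n| ≤
      ((4 * i + 2 : ℕ) : ℚ)).card : ℝ) ≤ η * N + (J - 2 * Real.pi * N + 1) := by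
  have hNr : (0 : ℝ) < N := by positivity
  have hpi := Real.pi_pos
  set S := (Finset.range J).filter fun n => ∀ k < L + 1, |riemannSum N v T k n| ≤
      ((4 * i + 2 : ℕ) : ℚ) with hS
  set F := ⌊2 * Real.pi * N⌋₊ with hF
  have hF0 : (F : ℝ) ≤ 2 * Real.pi * N := Nat.floor_le (by positivity)
  have hF1 : 2 * Real.pi * N < F + 1 := Nat.lt_floor_add_one _
  have hFJ : F ≤ J := by
    have : (F : ℝ) ≤ J := hF0.trans hJ
    exact_mod_cast this
  have h1 : (((S.filter (· < F)).card : ℝ)) / N ≤ η := by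
    have h := card_div_le_volume hN (S.filter (· < F))
      (E := {x | x ∈ Set.Icc 0 (2 * Real.pi) ∧
      ∀ k ≤ L, |dirInt (gridFun N (listVal v)) k x| ≤ 4 * i + 3}) (by
        intro n hn x hx
        rw [Finset.mem_filter, hS, Finset.mem_filter, Finset.mem_range] at hn
        obtain ⟨⟨hnJ, hbad⟩, hnF⟩ := hn
        have hnF' : (n : ℝ) + 1 ≤ F := by exact_mod_cast hnF
        refine ⟨⟨le_trans (by positivity) hx.1, hx.2.le.trans ((div_le_iff₀ hNr).2
          (hnF'.trans hF0))⟩, fun k hk => ?_⟩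
        have h2 := happ k hk n hnJ x hx.1 hx.2.le
        have h3 := (Rat.cast_le (K := ℝ)).2 (hbad k (by omega))
        push_cast at h3
        rw [abs_le] at *
        constructor <;> linarith [h2.1, h2.2, h3.1, h3.2])
    exact ((ENNReal.ofReal_lt_ofReal_iff hη).1 (h.trans_lt hvol)).le
  have h2 : (S.filter (¬ · < F)).card ≤ J - F := by
    have : S.filter (¬ · < F) ⊆ Finset.Ico F J := by
      intro n hn
      rw [Finset.mem_filter, hS, Finset.mem_filter, Finset.mem_range] at hn
      rw [Finset.mem_Ico]
      exact ⟨not_lt.1 hn.2, hn.1.1⟩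
    simpa using Finset.card_le_card this
  have h3 := Finset.card_filter_add_card_filter_not (s := S) (p := (· < F))
  have h4 : (((S.filter (¬ · < F)).card : ℝ)) ≤ J - F := by
    rw [← Nat.cast_sub hFJ]; exact_mod_cast h2
  rw [div_le_iff₀ hNr] at h1
  have h5 : (S.card : ℝ) = (S.filter (· < F)).card + (S.filter (¬ · < F)).card := by
    exact_mod_cast h3.symm
  linarith

theorem tendsto_cosErr (Y : ℚ) : Tendsto (fun T => (cosErr T Y : ℝ)) atTop (𝓝 0) := by
  have h := ((FloorSemiring.tendsto_pow_div_factorial_atTop (Y : ℝ)).comp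
    (tendsto_id.const_mul_atTop' (two_pos (α := ℕ)))).const_mul 2
  rw [mul_zero] at h
  refine h.congr fun T => ?_
  unfold cosErr
  rw [Finset.prod_div_distrib, Finset.prod_const, Finset.card_range]
  simp only [Function.comp_apply, id]
  rw [← Finset.prod_range_add_one_eq_factorial]
  push_cast
  ring

/-- The order of choice matters: first the function and `L`, then the radius, the bound `w` for
`2π`, the grid `N`, and last the Taylor degree `T`. The bound `A` on the norm does not depend on
`N`, so refining the grid is not circular. -/
theorem exists_good (c : BallCode) (hr : 0 < ratVal c.2) (i : ℕ) : ∃ t, Good c i t := by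
  have hpi := Real.pi_pos
  set r : ℝ := (ratVal c.2 : ℝ) with hrdef
  have hr' : 0 < r := Rat.cast_pos.2 hr
  have hi0 : (0 : ℝ) < 1 / (i + 1) := by positivity
  obtain ⟨C, hC0, hC⟩ := exists_stepVal_bound c.1
  -- The threshold `4i + 3` leaves `1` for the error of the Riemann sums, compared with `4i + 2` in
  -- `Good.count`. Half of the allowed measure is kept for the cells near `2π`.
  obtain ⟨f, hf, hnear, L, hvol⟩ := exists_isGrid_near c (half_pos hr') (4 * i + 3)
    (half_pos hi0)
  obtain ⟨N₂, hN₂, u, m, hm, hu, rfl⟩ := hf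
  have hN₂r : (0 : ℝ) < N₂ := by positivity
  obtain ⟨s, hs⟩ := exists_nat_gt (4 / r + i + 2 * L)
  have hs1 : (1 : ℝ) / (s + 1) < r / 4 := by
    have : 4 / r < s := lt_of_le_of_lt (by rw [add_assoc]; exact le_add_of_nonneg_right (by positivity)) hs
    rw [div_lt_iff₀ hr'] at this
    rw [div_lt_iff₀ (by positivity)]
    nlinarith
  have hs2 : i ≤ s := by
    have : (i : ℝ) < s := lt_of_le_of_lt (by
      have : 0 ≤ 4 / r := by positivity
      linarith [(Nat.cast_nonneg L : (0 : ℝ) ≤ L)]) hs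
    exact_mod_cast this.le
  have hs3 : 2 * L ≤ s := by
    have : (2 * L : ℝ) < s := lt_of_le_of_lt (by
      have : 0 ≤ 4 / r := by positivity
      linarith [(Nat.cast_nonneg i : (0 : ℝ) ≤ i)]) hs
    exact_mod_cast this.le
  -- the bound for `2π`
  set δ : ℝ := min (r / 16 / C) (1 / (i + 1) / 8) with hδ
  have hδ0 : 0 < δ := lt_min (by positivity) (by positivity)
  have hδ1 : C * δ ≤ r / 16 := by
    have := min_le_left (r / 16 / C) (1 / ((i : ℝ) + 1) / 8)
    rw [← hδ, le_div_iff₀ hC0] at this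
    linarith
  have hδ2 : δ ≤ 1 / (i + 1) / 8 := min_le_right _ _
  obtain ⟨w, hw1, hw2⟩ := ((tendsto_piLo.eventually (lt_mem_nhds hm)).and
    (tendsto_piHi.eventually (gt_mem_nhds (by linarith : 2 * Real.pi < 2 * Real.pi + δ)))).exists
  -- the grid
  obtain ⟨Cu, hCu0, hCu⟩ : ∃ Cu : ℝ, 0 ≤ Cu ∧ ∀ j, |(u j : ℝ)| ≤ Cu := by
    refine ⟨∑ j ∈ Finset.range m, |(u j : ℝ)|, Finset.sum_nonneg fun _ _ => abs_nonneg _,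
      fun j => ?_⟩
    rcases lt_or_ge j m with h | h
    · exact Finset.single_le_sum (f := fun j => |(u j : ℝ)|) (fun _ _ => abs_nonneg _)
        (Finset.mem_range.2 h)
    · rw [hu j h, Rat.cast_zero, abs_zero]
      exact Finset.sum_nonneg fun _ _ => abs_nonneg _
  set A : ℝ := Cu * (2 * Real.pi + 2 * δ) with hA
  have hA0 : 0 ≤ A := by positivity
  -- This gives `1 ≤ δ * N`, which absorbs rounding, and half of the error budget `1` for the
  -- discretization; `T` below takes the other half.
  obtain ⟨k, hk⟩ := exists_nat_gt (1 / δ + 4 * A * L ^ 2)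
  have hkpos : (0 : ℝ) < k := lt_of_le_of_lt (by positivity) hk
  have hk0 : 0 < k := by exact_mod_cast hkpos
  set q := commonDen c.1 * k with hq
  have hq0 : 0 < q := Nat.mul_pos (commonDen_pos _) hk0
  set N := N₂ * q with hN
  have hN0 : 0 < N := Nat.mul_pos hN₂ hq0
  have hNr : (0 : ℝ) < N := by exact_mod_cast hN0
  have hkN : (k : ℝ) ≤ N := by
    have h1 : k ≤ q := Nat.le_mul_of_pos_left k (commonDen_pos c.1)
    have h2 : q ≤ N := Nat.le_mul_of_pos_left q hN₂
    exact_mod_cast h1.trans h2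
  have hden : commonDen c.1 ∣ N := ⟨N₂ * k, by rw [hN, hq]; ring⟩
  have hN1 : 1 ≤ δ * N := by
    have h1 : 1 / δ ≤ N := (le_add_of_nonneg_right (by positivity)).trans (hk.le.trans hkN)
    rw [div_le_iff₀ hδ0] at h1
    linarith
  have hN2 : A * (2 * L ^ 2 / N) ≤ 1 / 2 := by
    have h1 : 4 * A * L ^ 2 ≤ N := (le_add_of_nonneg_left (by positivity)).trans (hk.le.trans hkN)
    have h2 : A * (2 * (L : ℝ) ^ 2 / N) = (4 * A * L ^ 2) / N / 2 := by ring
    have h3 : (4 * A * L ^ 2) / N ≤ 1 := (div_le_one hNr).2 h1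
    linarith
  set len := m * q with hlen
  obtain ⟨v, hvlen, hv⟩ := exists_list_code (fun j => u (j / q)) (len := len) fun j hj =>
    hu _ ((Nat.le_div_iff_mul_le hq0).2 hj)
  have hg : gridFun N (listVal v) = gridFun N₂ u := by rw [hv, hN, ← gridFun_refine N₂ q hq0]
  have hlenN : (len : ℝ) / N = m / N₂ := by
    have : (q : ℝ) ≠ 0 := by positivity
    rw [hlen, hN]; push_cast
    rw [mul_div_mul_right _ _ this]
  set J := ⌈(piHi w : ℝ) * N⌉₊ with hJ
  have hJ0 : (piHi w : ℝ) * N ≤ J := Nat.le_ceil _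
  have hJ1 : (J : ℝ) < piHi w * N + 1 :=
    Nat.ceil_lt_add_one (mul_nonneg (Real.two_pi_pos.le.trans (le_piHi w)) hNr.le)
  have hJ2 : 2 * Real.pi * N ≤ J := (mul_le_mul_of_nonneg_right (le_piHi w) hNr.le).trans hJ0
  have hJ2' : 2 * Real.pi ≤ (J : ℝ) / N := (le_div_iff₀ hNr).2 hJ2
  have hJ3 : (J : ℝ) ≤ 2 * Real.pi * N + δ * N + 1 := by
    have := mul_le_mul_of_nonneg_right hw2.le hNr.le
    linarith
  have hJ4 : (J : ℝ) / N ≤ 2 * Real.pi + 2 * δ := by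
    rw [div_le_iff₀ hNr]; linarith
  have hlen2 : (v.length : ℝ) / N ≤ 2 * Real.pi := by rw [hvlen, hlenN]; exact hm.le
  have hlenJ : v.length ≤ J := by
    have h1 := hlen2.trans hJ2'
    rw [div_le_div_iff_of_pos_right hNr] at h1
    exact_mod_cast h1
  set Y : ℚ := ((L * J : ℕ) : ℚ) / (N : ℚ) with hY
  have hY0 : 0 ≤ Y := by positivity
  obtain ⟨T, hT1, hT2⟩ := ((((tendsto_cosErr Y).const_mul (A * L)).eventually
    (gt_mem_nhds (by rw [mul_zero]; norm_num : A * L * 0 < (1 / 2 : ℝ)))).and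
    (eventually_ge_atTop ⌈Y⌉₊)).exists
  have htaylor : 2 * ((L * J : ℕ) : ℚ) / (N : ℚ) ≤ ((2 * T + 1 : ℕ) : ℚ) := by
    have h1 : Y ≤ T := (Nat.le_ceil Y).trans (by exact_mod_cast hT2)
    rw [mul_div_assoc, ← hY]
    push_cast
    linarith
  have hgrid : (gridNorm N v J : ℝ) ≤ A := by
    unfold gridNorm
    push_cast
    rw [hv, hA]
    have h1 : ∑ j ∈ Finset.range J, |((u (j / q) : ℚ) : ℝ)| ≤ J * Cu := by
      refine (Finset.sum_le_sum fun j _ => hCu (j / q)).trans ?_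
      simp
    calc (∑ j ∈ Finset.range J, |((u (j / q) : ℚ) : ℝ)|) / N ≤ J * Cu / N := by gcongr
      _ = Cu * (J / N) := by ring
      _ ≤ _ := by gcongr
  have herror : gridNorm N v J * (2 * ((L * L : ℕ) : ℚ) / (N : ℚ) +
      (L : ℚ) * cosErr T (((L * J : ℕ) : ℚ) / (N : ℚ))) ≤ 1 := by
    rw [← hY]
    have he0 : (0 : ℝ) ≤ cosErr T Y := by exact_mod_cast cosErr_nonneg hY0 T
    have h1 : (gridNorm N v J : ℝ) * (2 * L ^ 2 / N + L * cosErr T Y) ≤ 1 := by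
      calc (gridNorm N v J : ℝ) * (2 * L ^ 2 / N + L * cosErr T Y)
          ≤ A * (2 * L ^ 2 / N + L * cosErr T Y) := by gcongr
        _ = A * (2 * L ^ 2 / N) + A * L * cosErr T Y := by ring
        _ ≤ 1 := by linarith
    rw [← Rat.cast_le (K := ℝ)]
    push_cast
    rw [← pow_two]
    exact h1
  have happ : ∀ k ≤ L, ∀ n < J, ∀ x : ℝ, (n : ℝ) / N ≤ x → x ≤ (n + 1 : ℝ) / N →
      |dirInt (gridFun N (listVal v)) k x - (riemannSum N v T k n : ℝ)| ≤ 1 :=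
    fun k hk n hn x h0 h1 =>
      abs_dirInt_sub_riemannSum_le hN0 hlen2 hlenJ htaylor herror hk hn h0 h1
  have hcard := card_bad_le (i := i) hN0 (half_pos hi0) happ (by rw [hg]; exact hvol) hJ2
  refine ⟨⟨N, v, s, L, T, w, J⟩, Nat.mod_eq_zero_of_dvd hden, hN0, ?_, ?_, ?_, ?_, hs2, hs3,
    htaylor, herror, ?_⟩
  · have h1 : (v.length : ℝ) ≤ piLo w * N := by
      rw [← div_le_iff₀ hNr, hvlen, hlenN]; exact hw1.le
    exact_mod_cast h1
  · exact_mod_cast hJ0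
  · simp only
    rw [← Rat.cast_lt (K := ℝ), Rat.cast_add]
    have hint := integral_abs_gridFun hN0
      (fun j : ℕ => stepVal c.1 ((j : ℚ) / (N : ℚ)) - listVal v j) J
    have hii := fun a b : ℝ => (intervalIntegrable_gridFun N
      (fun j : ℕ => stepVal c.1 ((j : ℚ) / (N : ℚ)) - listVal v j) a b).abs
    rw [← intervalIntegral.integral_add_adjacent_intervals (hii 0 (2 * Real.pi))
      (hii (2 * Real.pi) (J / N))] at hint
    have h1 : ∫ t in (0 : ℝ)..(2 * Real.pi), |gridFun N
        (fun j : ℕ => stepVal c.1 ((j : ℚ) / (N : ℚ)) - listVal v j) t| < r / 2 := by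
      refine lt_of_eq_of_lt ?_ hnear
      refine nrm_congr ?_
      filter_upwards [codeClass_coeFn c hN0 hden] with t ht
      rw [ht, ← hg]
      simp [gridFun]
    -- Beyond `2π` the new function is zero, so only the values of the old step function, at most
    -- `C`, contribute.
    have h2 : ∫ t in (2 * Real.pi)..(J / N), |gridFun N
        (fun j : ℕ => stepVal c.1 ((j : ℚ) / (N : ℚ)) - listVal v j) t| ≤ C * (2 * δ) := by
      have h3 := intervalIntegral.norm_integral_le_of_norm_le_const (C := C) (a := 2 * Real.pi)
        (b := (J / N : ℝ)) (f := fun t => |gridFun N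
        (fun j : ℕ => stepVal c.1 ((j : ℚ) / (N : ℚ)) - listVal v j) t|) fun t ht => by
          rw [Set.uIoc_of_le hJ2'] at ht
          rw [Real.norm_eq_abs, abs_abs]
          unfold gridFun
          beta_reduce
          rw [listVal_eq_zero (Nat.le_floor ?_), sub_zero]
          · exact hC _
          · exact (div_le_iff₀ hNr).1 (hlen2.trans ht.1.le)
      rw [abs_of_nonneg (by linarith : 0 ≤ (J : ℝ) / N - 2 * Real.pi)] at h3
      refine (le_abs_self _).trans (h3.trans ?_)
      have : (J : ℝ) / N - 2 * Real.pi ≤ 2 * δ := by linarith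
      gcongr
    have h4 : ((((∑ j ∈ Finset.range J, |stepVal c.1 ((j : ℚ) / (N : ℚ)) - listVal v j|) /
        (N : ℚ) : ℚ)) : ℝ) = 1 / N * ∑ j ∈ Finset.range J,
        |((stepVal c.1 ((j : ℚ) / (N : ℚ)) - listVal v j : ℚ) : ℝ)| := by
      push_cast; ring
    rw [h4, ← hint]
    push_cast
    rw [← hrdef]
    linarith
  · rw [← Rat.cast_lt (K := ℝ)]
    push_cast
    rw [← hrdef]
    have : (2 : ℝ) / (s + 1) = 2 * (1 / (s + 1)) := by ring
    linarith
  · simp only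
    rw [Finset.sum_boole, ← Rat.cast_le (K := ℝ)]
    push_cast
    have h1 : (1 : ℝ) / (i + 1) * (i + 1) = 1 := by field_simp
    have h2 : δ * N ≤ 1 / (i + 1) / 8 * N := by gcongr
    have h3 := hcard.trans (by linarith :
      1 / ((i : ℝ) + 1) / 2 * N + (J - 2 * Real.pi * N + 1) ≤ 1 / (i + 1) * N)
    push_cast at h3
    calc _ ≤ 1 / ((i : ℝ) + 1) * N * (i + 1) := by gcongr
      _ = N := by linear_combination (N : ℝ) * h1

/-! ## The strategy -/

/-- The certificate search is run on the normal form of the input, so codes of the same ball receive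
literally the same output code. -/
theorem exists_strategy : ∃ F : BallCode × ℕ → BallCode, Computable F ∧
    (∀ c c' i, Equivalent c c' → F (c, i) = F (c', i)) ∧
    ∀ c i, 0 < ratVal c.2 → IsEndpointList (BallCode.endpoints (F (c, i))) ∧
      0 < ratVal (F (c, i)).2 ∧
      dist (codeClass (F (c, i))) (codeClass c) + (ratVal (F (c, i)).2 : ℝ) < ratVal c.2 ∧
      ratVal (F (c, i)).2 < ratVal c.2 / 2 ∧ ratVal (F (c, i)).2 ≤ 1 / ((i : ℚ) + 1) ∧
      ∀ f : LOne, dist f (codeClass (F (c, i))) < ratVal (F (c, i)).2 →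
        mu {x | ∀ k, |fourierPartialSum f k x| ≤ i} ≤ ENNReal.ofReal (1 / (i + 1)) := by
  obtain ⟨nf, hnf, hnf1, hnf2⟩ := exists_normal_form
  -- Codes with nonpositive radius describe no ball; accepting every certificate for them makes the
  -- search total.
  have hP : PrimrecPred fun p : (BallCode × ℕ) × Cert =>
      ratVal p.1.1.2 ≤ 0 ∨ Good p.1.1 p.1.2 p.2 := by
    refine PrimrecPred.or ?_ primrecPred_good
    fun_prop
  obtain ⟨g, hg, hg1, -⟩ := exists_computable_choice (α := BallCode × ℕ) (β := Cert)
    (P := fun (a : BallCode × ℕ) t => ratVal a.1.2 ≤ 0 ∨ Good a.1 a.2 t) hP.computablePred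
    fun a => by
      rcases le_or_gt (ratVal a.1.2) 0 with h | h
      · exact ⟨⟨0, [], 0, 0, 0, 0, 0⟩, Or.inl h⟩
      · exact (exists_good a.1 h a.2).imp fun _ => Or.inr
  refine ⟨fun p => (g (nf p.1, p.2)).out, ?_, fun c c' i h => ?_, fun c i hc => ?_⟩
  · exact primrec_out.to_comp.comp (hg.comp ((hnf.comp Computable.fst).pair Computable.snd))
  · simp only [hnf2 c c' h]
  · obtain ⟨e1, e2⟩ := hnf1 c
    have h : Good (nf c) i (g (nf c, i)) :=
      (hg1 (nf c, i)).resolve_left (not_le.2 (e2 ▸ hc))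
    refine ⟨isEndpointList_out h.pos, ?_, ?_, ?_, ?_, fun f hf => h.measure_le hf⟩
    · rw [ratVal_out]; positivity
    · rw [e1, e2]; exact h.dist_lt
    · rw [ratVal_out, e2, lt_div_iff₀ two_pos]
      have := h.half
      rwa [one_div_mul_eq_div]
    · rw [ratVal_out]
      have hs : (i : ℚ) ≤ (g (nf c, i)).s := by exact_mod_cast h.small
      push_cast
      gcongr

theorem exists_describes (B : RatBall) : ∃ c, Describes c B := by
  have hq : ∀ q : ℚ, ratVal (q.num, q.den - 1) = q := by
    intro q
    rw [ratVal, Nat.cast_sub q.den_pos]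
    simp [Rat.num_div_den]
  obtain ⟨l, hl, hc⟩ := B.center_step
  have he : BallCode.endpoints (l.map fun p => ((p.1.num, p.1.den - 1), (p.2.num, p.2.den - 1)),
      (B.radius.num, B.radius.den - 1)) = l := by
    simp [BallCode.endpoints, Function.comp_def, hq]
  refine ⟨(l.map fun p => ((p.1.num, p.1.den - 1), (p.2.num, p.2.den - 1)),
    (B.radius.num, B.radius.den - 1)), ?_, ?_, (hq _).symm⟩ <;> rw [he] <;> assumption

/-- The move is defined through an arbitrary, noncomputable choice of a code for each ball. It is
nevertheless computed by `F`, because `F` does not distinguish equivalent codes. -/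
theorem exists_constructor : ∃ β : Constructor, β.IsComputable ∧ β.IsShrinking ∧
    (∀ B i, dist (β.move B i).center B.center + ((β.move B i).radius : ℝ) < B.radius) ∧
    (∀ B i, (β.move B i).radius ≤ 1 / ((i : ℚ) + 1)) ∧
    ∀ B i, ∀ f ∈ (β.move B i).toSet,
      mu {x | ∀ k, |fourierPartialSum f k x| ≤ i} ≤ ENNReal.ofReal (1 / (i + 1)) := by
  obtain ⟨F, hF, hF1, hF2⟩ := exists_strategy
  choose code hcode using exists_describes
  have hpos : ∀ B, 0 < ratVal (code B).2 := fun B => (hcode B).2.2 ▸ B.radius_pos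
  have hcen : ∀ B, codeClass (code B) = B.center := fun B => (hcode B).2.1.symm
  set move : RatBall → ℕ → RatBall := fun B i =>
    ⟨codeClass (F (code B, i)), ratVal (F (code B, i)).2, (hF2 _ i (hpos B)).2.1,
      ⟨_, (hF2 _ i (hpos B)).1, rfl⟩⟩ with hmove
  have hnear : ∀ B i, dist (move B i).center B.center + ((move B i).radius : ℝ) < B.radius := by
    intro B i
    have h := (hF2 _ i (hpos B)).2.2.1
    rwa [hcen, ← (hcode B).2.2] at h
  refine ⟨⟨move, fun B i f hf => ?_⟩, ⟨F, hF, fun c B i hc => ?_⟩, fun B i => ?_, hnear,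
    fun B i => (hF2 _ i (hpos B)).2.2.2.2.1, fun B i f hf => (hF2 _ i (hpos B)).2.2.2.2.2 f hf⟩
  · have h1 : dist f (move B i).center < (move B i).radius := hf
    have h2 := dist_triangle f (move B i).center B.center
    have h3 := hnear B i
    exact Metric.mem_ball.2 (by linarith)
  · have h : Equivalent c (code B) :=
      ⟨hc.2.1.symm.trans (hcode B).2.1, hc.2.2.symm.trans (hcode B).2.2⟩
    rw [hF1 c (code B) i h]
    exact ⟨(hF2 _ i (hpos B)).1, rfl, rfl⟩
  · have h := (hF2 _ i (hpos B)).2.2.2.1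
    rwa [← (hcode B).2.2] at h

/-! ### Divergence from measure bounds, and the outcome of the game -/

/-- The set where the partial sums are bounded by `K` lies in the one for every `i ≥ K`, hence is
null. Convergent sequences are bounded, so convergence occurs only on a countable union of such null
sets. -/
theorem fourierDivergesAE_of_measure_le {f : LOne}
    (h : ∀ i : ℕ, mu {x | ∀ k, |fourierPartialSum f k x| ≤ i} ≤ ENNReal.ofReal (1 / (i + 1))) :
    FourierDivergesAE f := by
  have hz : ∀ K : ℕ, mu {x | ∀ k, |fourierPartialSum f k x| ≤ K} = 0 := by
    intro K
    have hlim : Tendsto (fun i : ℕ => ENNReal.ofReal (1 / ((i : ℝ) + 1))) atTop (𝓝 0) := by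
      rw [← ENNReal.ofReal_zero]
      exact (ENNReal.continuous_ofReal.tendsto 0).comp tendsto_one_div_add_atTop_nhds_zero_nat
    refine le_antisymm (ge_of_tendsto hlim ?_) zero_le
    filter_upwards [eventually_ge_atTop K] with i hi
    refine (measure_mono fun x hx k => (hx k).trans ?_).trans (h i)
    exact_mod_cast hi
  rw [FourierDivergesAE, ae_iff]
  refine measure_mono_null ?_ (measure_iUnion_null hz)
  intro x hx
  obtain ⟨s, hs⟩ := not_not.1 hx
  obtain ⟨C, hC⟩ := hs.abs.bddAbove_range
  obtain ⟨K, hK⟩ := exists_nat_ge C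
  exact Set.mem_iUnion.2 ⟨K, fun k => (hC ⟨k, rfl⟩).trans hK⟩

theorem exists_play_eq (α β : Constructor) (B : RatBall) (i : ℕ) :
    ∃ B', play α β B i = β.move B' i := by
  cases i with
  | zero => exact ⟨_, rfl⟩
  | succ i => exact ⟨_, rfl⟩

/-- Cantor's intersection theorem applies to the closed balls: the strict inequality `h1` puts each
closed ball inside the preceding open one, so the limit point lies in all open balls. -/
theorem iInter_play_eq_singleton (α : Constructor) {β : Constructor}
    (h1 : ∀ B i, dist (β.move B i).center B.center + ((β.move B i).radius : ℝ) < B.radius)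
    (h2 : ∀ B i, (β.move B i).radius ≤ 1 / ((i : ℚ) + 1)) (B : RatBall) :
    ∃ f : LOne, ⋂ i, (play α β B i).toSet = {f} := by
  set R := play α β B with hR
  have hrad : ∀ i, ((R i).radius : ℝ) ≤ 1 / ((i : ℝ) + 1) := by
    intro i
    obtain ⟨B', hB'⟩ := exists_play_eq α β B i
    rw [hR, hB']
    have := (Rat.cast_le (K := ℝ)).2 (h2 B' i)
    push_cast at this
    exact this
  have hsub : ∀ i, Metric.closedBall (R (i + 1)).center (R (i + 1)).radius ⊆ (R i).toSet := by
    intro i f hf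
    refine α.move_subset (R i) (i + 1) ?_
    have h := h1 (α.move (R i) (i + 1)) (i + 1)
    have hf' : dist f (R (i + 1)).center ≤ (R (i + 1)).radius := hf
    have e : R (i + 1) = β.move (α.move (R i) (i + 1)) (i + 1) := rfl
    rw [e] at hf'
    refine Metric.mem_ball.2 ?_
    linarith [dist_triangle f (β.move (α.move (R i) (i + 1)) (i + 1)).center
      (α.move (R i) (i + 1)).center]
  have hpos : ∀ i, (0 : ℝ) < (R i).radius := fun i => by exact_mod_cast (R i).radius_pos
  have hlim := (tendsto_one_div_add_atTop_nhds_zero_nat (𝕜 := ℝ)).const_mul 2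
  rw [mul_zero] at hlim
  set s : ℕ → Set LOne := fun i => Metric.closedBall (R i).center (R i).radius with hs
  have hanti : Antitone s := antitone_nat_of_succ_le fun i =>
    (hsub i).trans Metric.ball_subset_closedBall
  obtain ⟨f, hf⟩ := Metric.nonempty_iInter_of_nonempty_biInter (s := s)
    (fun i => Metric.isClosed_closedBall) (fun i => Metric.isBounded_closedBall)
    (fun N => ⟨(R N).center, Set.mem_iInter₂.2 fun n hn =>
      hanti hn (Metric.mem_closedBall_self (hpos N).le)⟩)
    (by
      refine squeeze_zero (fun _ => Metric.diam_nonneg) (fun i => ?_) hlim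
      exact (Metric.diam_closedBall (hpos i).le).trans (by linarith [hrad i]))
  rw [Set.mem_iInter] at hf
  refine ⟨f, Set.eq_singleton_iff_unique_mem.2 ⟨Set.mem_iInter.2 fun i => hsub i (hf (i + 1)),
    fun g hg => ?_⟩⟩
  rw [Set.mem_iInter] at hg
  refine dist_le_zero.1 (ge_of_tendsto hlim (b := dist g f)
    (Eventually.of_forall fun i => ?_))
  have a1 : dist g (R i).center < (R i).radius := hg i
  have a2 : dist f (R i).center ≤ (R i).radius := hf i
  linarith [dist_triangle_right g f (R i).center, hrad i]

end LOneRec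

end

theorem mainTheorem1 :
    LOneRec.IsRecMeager {f : LOneRec.LOne | ¬ LOneRec.FourierDivergesAE f} ∧
      ∃ β : LOneRec.Constructor, β.IsComputable ∧ β.IsShrinking ∧
        β.Wins {f : LOneRec.LOne | ¬ LOneRec.FourierDivergesAE f} := by
  obtain ⟨β, hcomp, hshrink, hnear, hrad, hmeas⟩ := LOneRec.exists_constructor
  -- Removing from the set all balls that `β` can produce at index `i` makes the avoidance condition
  -- automatic. These pieces cover it: an element missed by all of them would lie in some `β(B,i)`
  -- for every `i` and so have an almost everywhere divergent series.
  refine ⟨⟨fun i => {f | ¬ LOneRec.FourierDivergesAE f} \ ⋃ B, (β.move B i).toSet, ?_, β, hcomp,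
    fun B i => ?_⟩, β, hcomp, hshrink, fun α B => ?_⟩
  · refine Set.Subset.antisymm (fun f hf => ?_) (Set.iUnion_subset fun i => Set.sdiff_subset)
    by_contra hcon
    refine hf (LOneRec.fourierDivergesAE_of_measure_le fun i => ?_)
    rw [Set.mem_iUnion, not_exists] at hcon
    have h : f ∈ ⋃ B, (β.move B i).toSet := by
      by_contra h
      exact hcon i ⟨hf, h⟩
    obtain ⟨B, hB⟩ := Set.mem_iUnion.1 h
    exact hmeas B i f hB
  · refine Set.eq_empty_iff_forall_notMem.2 fun f hf => hf.2.2 (Set.mem_iUnion.2 ⟨B, hf.1⟩)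
  · obtain ⟨f, hf⟩ := LOneRec.iInter_play_eq_singleton α hnear hrad B
    refine ⟨f, hf, not_not.2 (LOneRec.fourierDivergesAE_of_measure_le fun i => ?_)⟩
    obtain ⟨B', hB'⟩ := LOneRec.exists_play_eq α β B i
    have h : f ∈ ⋂ i, (LOneRec.play α β B i).toSet := hf ▸ rfl
    exact hmeas B' i f (hB' ▸ Set.mem_iInter.1 h i)
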